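/- **Setting.** Let $\mathcal P$ be the class of probability densities on $\mathbb R$. Let $\mathcal C$ be the class of closed (upper semicontinuous), proper, concave functions $\mathbb R\to[-\infty,\infty)$, and $\mathcal{SC}_0$ the subclass of functions symmetric about $0$; write $\operatorname{dom}\psi=\{\psi>-\infty\}$. Let $\mathcal P_1$ be the class of bounded densities with finite first moment that are symmetric about some point. Let $\mathcal P_0$ be the class of densities $f=g(\cdot-\theta)$, $\theta\in\mathbb R$, with $g$ a density symmetric about $0$, $\log g\in\mathcal C$, and finite Fisher information for location ($f$ is absolutely continuous and $\int (f'/f)^2f<\infty$). For a probability measure $F$ on $\mathbb R$ put $$\omega(\varphi,F)=\int\varphi\,dF-\int e^{\varphi(x)}dx,\qquad \Psi(\theta,\psi,F)=\int\psi(x-\theta)\,dF(x)-\int e^{\psi(x-\theta)}dx,$$ $$L(F)=\sup_{\theta\in\mathbb R,\ \psi\in\mathcal{SC}_0}\Psi(\theta,\psi,F).$$ The log-concave projection of $F$ is $e^{\varphi}$, where $\varphi$ maximizes $\omega(\cdot,F)$ over $\mathcal C$. A maximum likelihood estimate (MLE) based on $X_1,\dots,X_n$ with empirical measure $\mathbb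 F_n$ is a maximizer $(\hat\theta_n,\hat\psi_n)$ of $\Psi(\cdot,\cdot,\mathbb F_n)$ over $\mathbb R\times\mathcal{SC}_0$, and $\hat g_n=e^{\hat\psi_n}$. **Theorem.** One has $\mathcal P_0\subseteq\mathcal P_1$. Let $f_0\in\mathcal P_1$ be symmetric about $\theta_0$, let $F_0$ be the distribution with density $f_0$, and let $g_0=f_0(\cdot+\theta_0)$. Then the distribution with density $g_0$ has a unique log-concave projection $g^*=e^{\psi^*}$; $g^*$ is a probability density; $(\theta_0,\psi^*)$ is the unique maximizer of $\Psi(\cdot,\cdot,F_0)$ over $\mathbb R\times\mathcal{SC}_0$; and $L(F_0)$ is finite. If $f_0\in\mathcal P_0$, then $g^*=g_0$, that is, $\psi^*=\log g_0$. Moreover there is $\alpha>0$, depending only on $f_0$, such that for i.i.d. random variables $X_1,X_2,\dots$ with density $f_0$ the following hold. Almost surely an MLE exists for every $n\ge2$, and $L(\mathbb F_n)\to L(F_0)$. For every choice of MLEs $(\hat\theta_n,\hat\psi_n)$, almost surely, as $n\to\infty$: (a) $\hat\theta_n\to\theta_0$; (b) $\hat\psi_n(x)\to\psi^*(x)$ for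 all $x\in\operatorname{int}(\operatorname{dom}\psi^*)$; (c) $\limsup_n\hat\psi_n(x)\le\psi^*(x)$ for all $x\in\mathbb R$; (d) $\hat g_n(x)\to g^*(x)$ at every continuity point $x$ of $g^*$ (that is, everywhere except possibly at the two endpoints of the support of $g^*$ when $g^*$ jumps there); (e) $\int e^{\alpha_1|x|}\,|\hat g_n(x)-g^*(x)|\,dx\to0$ for all $\alpha_1<\alpha$; and if $g^*$ is continuous on $\mathbb R$, then also $\sup_{x}e^{\alpha_1|x|}\,|\hat g_n(x)-g^*(x)|\to0$ for all $\alpha_1<\alpha$. In particular, if $f_0\in\mathcal P_0$, then almost surely $\hat g_n(x)\to g_0(x)$ for all $x\in\mathbb R$, and $\sup_{x}e^{\alpha_1|x|}\,|\hat g_n(x)-g_0(x)|\to0$ for all $\alpha_1<\alpha$. -/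

import Mathlib

open MeasureTheory ProbabilityTheory Filter Topology
open scoped ENNReal

noncomputable section

namespace SymmLoc

/-- The class `𝒫`: probability densities on the real line. -/
structure IsDensity (f : ℝ → ℝ) : Prop where
  measurable : Measurable f
  nonneg : ∀ x, 0 ≤ f x
  lintegral_eq_one : ∫⁻ x, ENNReal.ofReal (f x) = 1

/-- Symmetry about `θ`. -/
def SymmAbout {β : Type*} (θ : ℝ) (f : ℝ → β) : Prop :=
  ∀ x, f (θ + x) = f (θ - x)

/-- The class `𝒞` of closed proper concave functions `ℝ → [-∞, ∞)`: the hypograph is convex,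
the value `+∞` is never taken, the value `-∞` is not taken everywhere, and the function is upper
semicontinuous (which is what closedness means for a proper concave function). -/
structure ClosedProperConcave (φ : ℝ → EReal) : Prop where
  convex_hypograph : Convex ℝ {p : ℝ × ℝ | (p.2 : EReal) ≤ φ p.1}
  lt_top : ∀ x, φ x < ⊤
  exists_ne_bot : ∃ x, φ x ≠ ⊥
  upperSemicontinuous : UpperSemicontinuous φ

/-- The class `𝒮𝒞_θ`: members of `𝒞` that are symmetric about `θ`. -/
def SC (θ : ℝ) (φ : ℝ → EReal) : Prop :=
  ClosedProperConcave φ ∧ SymmAbout θ φ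

/-- The effective domain `{φ > -∞}`. -/
def dom (φ : ℝ → EReal) : Set ℝ := {x | φ x ≠ ⊥}

/-- The real function `e^φ`, with `e^{-∞} = 0`. -/
def expFun (φ : ℝ → EReal) (x : ℝ) : ℝ := (φ x).exp.toReal

/-- The extended-real log-density `log f`, with `log 0 = -∞`. -/
def logFun (f : ℝ → ℝ) (x : ℝ) : EReal := (ENNReal.ofReal (f x)).log

/-- The class `𝒮ℒ𝒞_θ`: log-concave densities that are symmetric about `θ`. -/
def SLC (θ : ℝ) (f : ℝ → ℝ) : Prop :=
  IsDensity f ∧ ClosedProperConcave (logFun f) ∧ SymmAbout θ f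

/-- Finite Fisher information for location: `f` is (locally) absolutely continuous and
`∫ (f' / f)² f < ∞`. -/
def FiniteFisherInfo (f : ℝ → ℝ) : Prop :=
  (∀ a b : ℝ, AbsolutelyContinuousOnInterval f a b) ∧
    ∫⁻ x, ENNReal.ofReal ((deriv f x / f x) ^ 2 * f x) < ⊤

/-- The log-concave symmetric location model `𝒫₀`. -/
def MemP0 (f : ℝ → ℝ) : Prop :=
  IsDensity f ∧ (∃ (θ : ℝ) (g : ℝ → ℝ), SLC 0 g ∧ ∀ x, f x = g (x - θ)) ∧ FiniteFisherInfo f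

/-- The model `𝒫₁`: bounded densities, symmetric about some point, with finite first moment. -/
def MemP1 (f : ℝ → ℝ) : Prop :=
  IsDensity f ∧ (∃ θ, SymmAbout θ f) ∧ (∃ C, ∀ x, f x ≤ C) ∧
    ∫⁻ x, ENNReal.ofReal (|x| * f x) < ⊤

/-- The distribution with density `f`. -/
def law (f : ℝ → ℝ) : Measure ℝ := volume.withDensity fun x => ENNReal.ofReal (f x)

/-- The integral `∫ h dμ ∈ [-∞, ∞]` of an extended-real function, `∫ h⁺ dμ - ∫ h⁻ dμ`. -/
def eintegral (h : ℝ → EReal) (μ : Measure ℝ) : EReal :=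
  ((∫⁻ x, (h x).toENNReal ∂μ : ℝ≥0∞) : EReal) - ((∫⁻ x, (-h x).toENNReal ∂μ : ℝ≥0∞) : EReal)

/-- The criterion `ω(φ, μ) = ∫ φ dμ - ∫ e^φ dx`. -/
def omega (φ : ℝ → EReal) (μ : Measure ℝ) : EReal :=
  eintegral φ μ - ((∫⁻ x, (φ x).exp : ℝ≥0∞) : EReal)

/-- The criterion `Ψ(θ, ψ, μ) = ∫ ψ(x - θ) dμ(x) - ∫ e^{ψ(x - θ)} dx`. -/
def Psi (θ : ℝ) (ψ : ℝ → EReal) (μ : Measure ℝ) : EReal :=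
  omega (fun x => ψ (x - θ)) μ

/-- The maximized criterion `L(μ) = sup_{θ ∈ ℝ, ψ ∈ 𝒮𝒞₀} Ψ(θ, ψ, μ)`. -/
def L (μ : Measure ℝ) : EReal :=
  ⨆ (θ : ℝ) (ψ : ℝ → EReal) (_ : SC 0 ψ), Psi θ ψ μ

/-- `(θ, ψ)` is a maximizer of `Ψ(·, ·, μ)` over `ℝ × 𝒮𝒞₀`. -/
def IsMaximizer (μ : Measure ℝ) (θ : ℝ) (ψ : ℝ → EReal) : Prop :=
  SC 0 ψ ∧ ∀ (θ' : ℝ) (ψ' : ℝ → EReal), SC 0 ψ' → Psi θ' ψ' μ ≤ Psi θ ψ μ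

/-- `e^φ` is the log-concave projection of `μ`: `φ` maximizes `ω(·, μ)` over `𝒞`. -/
def IsLogConcaveProjection (μ : Measure ℝ) (φ : ℝ → EReal) : Prop :=
  ClosedProperConcave φ ∧ ∀ χ : ℝ → EReal, ClosedProperConcave χ → omega χ μ ≤ omega φ μ

/-- The empirical measure of `x 0, …, x (n - 1)`. -/
def empirical (x : ℕ → ℝ) (n : ℕ) : Measure ℝ :=
  (n : ℝ≥0∞)⁻¹ • ∑ i ∈ Finset.range n, Measure.dirac (x i)

/-- `(θ, ψ)` is a maximum likelihood estimate based on the sample `x 0, …, x (n - 1)`. -/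
def IsMLE (x : ℕ → ℝ) (n : ℕ) (θ : ℝ) (ψ : ℝ → EReal) : Prop :=
  IsMaximizer (empirical x n) θ ψ

/-- The weighted `L₁` distance `∫ e^{a|x|} |g(x) - h(x)| dx`. -/
def weightedL1 (a : ℝ) (g h : ℝ → ℝ) : ℝ≥0∞ :=
  ∫⁻ x, ENNReal.ofReal (Real.exp (a * |x|) * |g x - h x|)

/-- The weighted uniform distance `sup_x e^{a|x|} |g(x) - h(x)|`. -/
def weightedSup (a : ℝ) (g h : ℝ → ℝ) : ℝ≥0∞ :=
  ⨆ x : ℝ, ENNReal.ofReal (Real.exp (a * |x|) * |g x - h x|)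

end SymmLoc

end

namespace SymmLoc

/-! Consistency follows from compactness and upper semicontinuity of the criterion together with
uniqueness of the population maximizer.

A lower bound `c ≤ Ψ(θ, ψ, μ)` gives three bounds in turn. If `μ` is not concentrated on short
intervals, `ψ(0)` is bounded (`exists_apply_zero_le`). Then `∫ e^ψ` is bounded, so `ψ` lies below a
tent of fixed slope (`SC.exists_drop`, `SC.le_tent`). Then `θ` is bounded through the first moment
(`abs_le_of_le_Psi`). Symmetric concave functions decrease in `|x|`, so a Helly-type selection
extracts limits in the sense of `HypoTendsto` (`exists_subseq_hypoTendsto`). Subtracting the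
criterion from an upper bound `B` of `ψ` leaves two integrals of nonnegative functions, and Fatou's
lemma, for varying measures in the first integral, yields upper semicontinuity
(`le_Psi_of_eventually_le`). The outcome, `exists_subseq_limit`, gives existence of maximizers, the
upper half of `L(F_n) → L(F_0)`, and subsequential convergence of the estimates. The lower half
needs only the strong law at the single pair `(θ₀, ψ*)`.

Uniqueness rests on strict concavity: at a midpoint the linear term is affine and the exponential
term gains by the AM-GM inequality (`omega_midpointFun_ge`). Averaging with the reflection then
shows that the projection of a symmetric law is symmetric (`exists_projection`). A symmetric concave
`ψ` with `∫ e^ψ < ∞` has only one centre of symmetry, which identifies `θ`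
(`SC.eq_zero_of_symmAbout`). In the well-specified case Gibbs' inequality identifies `ψ*`
(`SLC.omega_le`).

Finally, the values at the two points `0` and `R` already give a common exponential envelope
(`SC.exists_envelope`). Dominated convergence gives the weighted `L₁` statement, and monotonicity in
`|x|` upgrades pointwise to uniform convergence. -/

/-! ### Extended-real integrals and the criterion -/

lemma eintegral_mono {h k : ℝ → EReal} (μ : Measure ℝ) (hk : ∀ x, h x ≤ k x) :
    eintegral h μ ≤ eintegral k μ := by
  unfold eintegral
  refine EReal.sub_le_sub ?_ ?_
  · exact EReal.coe_ennreal_le_coe_ennreal_iff.2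
      (lintegral_mono fun x => EReal.toENNReal_le_toENNReal (hk x))
  · exact EReal.coe_ennreal_le_coe_ennreal_iff.2
      (lintegral_mono fun x => EReal.toENNReal_le_toENNReal (EReal.neg_le_neg_iff.2 (hk x)))

lemma eintegral_congr_ae {h k : ℝ → EReal} {μ : Measure ℝ} (hk : h =ᵐ[μ] k) :
    eintegral h μ = eintegral k μ := by
  unfold eintegral
  congr 2
  · exact lintegral_congr_ae (hk.mono fun x hx => by simp only [hx])
  · exact lintegral_congr_ae (hk.mono fun x hx => by simp only [hx])

lemma coe_ennreal_sub_of_ne_top {a b : ℝ≥0∞} (ha : a ≠ ⊤) (hb : b ≠ ⊤) :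
    ((a : EReal) - (b : EReal)) = ((a.toReal - b.toReal : ℝ) : EReal) := by
  lift a to NNReal using ha
  lift b to NNReal using hb
  rfl

lemma eintegral_coe {v : ℝ → ℝ} {μ : Measure ℝ} (hv : Integrable v μ) :
    eintegral (fun x => (v x : EReal)) μ = ((∫ x, v x ∂μ : ℝ) : EReal) := by
  have h1 : ∫⁻ x, ENNReal.ofReal (v x) ∂μ ≠ ⊤ :=
    (hv.lintegral_lt_top).ne
  have h2 : ∫⁻ x, ENNReal.ofReal (-v x) ∂μ ≠ ⊤ :=
    (hv.neg.lintegral_lt_top).ne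
  rw [integral_eq_lintegral_pos_part_sub_lintegral_neg_part hv, ← coe_ennreal_sub_of_ne_top h1 h2]
  rfl

/-- `φ` is `μ`-almost everywhere finite and integrable, and `e^φ` has finite integral. -/
structure OmegaFinite (φ : ℝ → EReal) (μ : Measure ℝ) : Prop where
  ae_ne_bot : ∀ᵐ x ∂μ, φ x ≠ ⊥
  integrable : Integrable (fun x => (φ x).toReal) μ
  lintegral_exp_ne_top : ∫⁻ x, (φ x).exp ≠ ⊤

lemma OmegaFinite.eintegral_eq {φ : ℝ → EReal} {μ : Measure ℝ} (h : OmegaFinite φ μ)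
    (htop : ∀ x, φ x < ⊤) :
    eintegral φ μ = ((∫ x, (φ x).toReal ∂μ : ℝ) : EReal) := by
  rw [← eintegral_coe h.integrable]
  refine eintegral_congr_ae (h.ae_ne_bot.mono fun x hx => ?_)
  exact (EReal.coe_toReal (htop x).ne hx).symm

lemma OmegaFinite.omega_eq {φ : ℝ → EReal} {μ : Measure ℝ} (h : OmegaFinite φ μ)
    (htop : ∀ x, φ x < ⊤) :
    omega φ μ = ((∫ x, (φ x).toReal ∂μ - (∫⁻ x, (φ x).exp).toReal : ℝ) : EReal) := by
  unfold omega
  rw [h.eintegral_eq htop]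
  lift ∫⁻ x, (φ x).exp to NNReal using h.lintegral_exp_ne_top with I
  rfl

/-- In `EReal` one has `⊤ - ⊤ = ⊥`, so an infinite negative part, or an infinite `∫ e^φ`, forces the
value `⊥` whatever the other terms are. -/
lemma lintegral_ne_top_of_omega_ne_bot {φ : ℝ → EReal} {μ : Measure ℝ} (h : omega φ μ ≠ ⊥) :
    ∫⁻ x, (-φ x).toENNReal ∂μ ≠ ⊤ ∧ ∫⁻ x, (φ x).exp ≠ ⊤ := by
  constructor
  · intro h'
    apply h
    unfold omega eintegral
    simp [h']
  · intro h'
    apply h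
    unfold omega
    simp [h']

lemma ae_ne_bot_of_lintegral_neg {φ : ℝ → EReal} {μ : Measure ℝ} (hm : Measurable φ)
    (h : ∫⁻ x, (-φ x).toENNReal ∂μ ≠ ⊤) : ∀ᵐ x ∂μ, φ x ≠ ⊥ := by
  have hm' : Measurable fun x => (-φ x).toENNReal := by fun_prop
  filter_upwards [ae_lt_top hm' h] with x hx hx'
  simp [hx'] at hx

lemma finite_of_omega_ne_bot {φ : ℝ → EReal} {μ : Measure ℝ} (hm : Measurable φ)
    (htop : ∀ x, φ x < ⊤) (hpos : ∫⁻ x, (φ x).toENNReal ∂μ ≠ ⊤) (h : omega φ μ ≠ ⊥) :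
    OmegaFinite φ μ := by
  obtain ⟨h1, h2⟩ := lintegral_ne_top_of_omega_ne_bot h
  have h3 := ae_ne_bot_of_lintegral_neg hm h1
  refine ⟨h3, ⟨hm.ereal_toReal.aestronglyMeasurable, ?_⟩, h2⟩
  have hle : ∫⁻ x, ‖(φ x).toReal‖ₑ ∂μ ≤ ∫⁻ x, ((φ x).toENNReal + (-φ x).toENNReal) ∂μ := by
    refine lintegral_mono_ae (h3.mono fun x hx => ?_)
    have := (htop x).ne
    generalize φ x = y at *
    lift y to ℝ using ⟨this, hx⟩
    rw [EReal.toReal_coe, Real.enorm_eq_ofReal_abs, ← EReal.coe_neg, EReal.real_coe_toENNReal,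
      EReal.real_coe_toENNReal]
    rcases le_total 0 y with hy | hy
    · rw [abs_of_nonneg hy]; exact le_self_add
    · rw [abs_of_nonpos hy]; exact le_add_self
  refine hle.trans_lt ?_
  rw [lintegral_add_left (by fun_prop)]
  exact ENNReal.add_lt_top.2 ⟨hpos.lt_top, h1.lt_top⟩

lemma lintegral_toENNReal_ne_top_of_le {φ : ℝ → EReal} {μ : Measure ℝ} [IsFiniteMeasure μ] {M : ℝ}
    (hM : ∀ x, φ x ≤ M) : ∫⁻ x, (φ x).toENNReal ∂μ ≠ ⊤ := by
  refine ne_of_lt ((lintegral_mono (g := fun _ => ENNReal.ofReal M) fun x => ?_).trans_lt ?_)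
  · exact EReal.toENNReal_le_toENNReal (hM x)
  · simp only [lintegral_const]
    exact ENNReal.mul_lt_top ENNReal.ofReal_lt_top (measure_lt_top _ _)

/-- Integrates the pointwise identity `(M - y) + y⁺ = M + y⁻`, which also holds at `y = -∞`. It
turns a difference of two integrals into one integral of a nonnegative function, to which Fatou's
lemma applies. -/
lemma eintegral_eq_sub {φ : ℝ → EReal} {μ : Measure ℝ} [IsProbabilityMeasure μ] {M : ℝ}
    (h0 : 0 ≤ M) (hm : Measurable φ) (hM : ∀ x, φ x ≤ M) :
    eintegral φ μ = (M : EReal) - ((∫⁻ x, (M - φ x).toENNReal ∂μ : ℝ≥0∞) : EReal) := by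
  have hpos := lintegral_toENNReal_ne_top_of_le (μ := μ) hM
  have key : ∫⁻ x, (M - φ x).toENNReal ∂μ + ∫⁻ x, (φ x).toENNReal ∂μ
      = ENNReal.ofReal M + ∫⁻ x, (-φ x).toENNReal ∂μ := by
    rw [← lintegral_add_right _ (by fun_prop)]
    have : ENNReal.ofReal M = ∫⁻ _, ENNReal.ofReal M ∂μ := by simp
    rw [this, ← lintegral_add_left (by fun_prop)]
    congr 1 with x
    have := hM x
    generalize φ x = y at *
    induction y with
    | bot => simp [sub_eq_add_neg]
    | top => simp at this
    | coe y =>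
      rw [← EReal.coe_sub, ← EReal.coe_neg]
      simp only [EReal.real_coe_toENNReal]
      have hy : y ≤ M := by exact_mod_cast this
      rcases le_total 0 y with h | h
      · rw [← ENNReal.ofReal_add (by linarith) h, ENNReal.ofReal_of_nonpos (p := -y) (by linarith)]
        simp
      · rw [← ENNReal.ofReal_add h0 (by linarith), ENNReal.ofReal_of_nonpos (p := y) (by linarith)]
        simp [sub_eq_add_neg]
  unfold eintegral
  set A := ∫⁻ x, (M - φ x).toENNReal ∂μ
  set P := ∫⁻ x, (φ x).toENNReal ∂μ
  set N := ∫⁻ x, (-φ x).toENNReal ∂μ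
  clear_value A P N
  by_cases hN : N = ⊤
  · have hA : A = ⊤ := by
      by_contra hA
      have : A + P ≠ ⊤ := ENNReal.add_ne_top.2 ⟨hA, hpos⟩
      rw [key, hN] at this
      simp at this
    rw [hN, hA]; simp
  · have hA : A ≠ ⊤ := by
      intro hA
      have : A + P ≠ ⊤ := by
        rw [key]; exact ENNReal.add_ne_top.2 ⟨by simp, hN⟩
      rw [hA] at this
      simp at this
    rw [coe_ennreal_sub_of_ne_top hpos hN]
    have h2 := congrArg ENNReal.toReal key
    rw [ENNReal.toReal_add hA hpos, ENNReal.toReal_add (by simp) hN, ENNReal.toReal_ofReal h0] at h2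
    have h3 : (M : EReal) - (A : EReal) = ((M - A.toReal : ℝ) : EReal) := by
      lift A to NNReal using hA
      rfl
    rw [h3]
    congr 1
    linarith

/-- For `φ ≤ M`, lower bounds for `ω(φ, μ)` are upper bounds for a sum of two integrals of
nonnegative functions. -/
lemma le_omega_iff {φ : ℝ → EReal} {μ : Measure ℝ} [IsProbabilityMeasure μ] {M c : ℝ}
    (h0 : 0 ≤ M) (hm : Measurable φ) (hM : ∀ x, φ x ≤ M) (hc : c ≤ M) :
    (c : EReal) ≤ omega φ μ ↔
      ∫⁻ x, (M - φ x).toENNReal ∂μ + ∫⁻ x, (φ x).exp ≤ ENNReal.ofReal (M - c) := by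
  unfold omega
  rw [eintegral_eq_sub h0 hm hM]
  generalize ∫⁻ x, (M - φ x).toENNReal ∂μ = A
  generalize ∫⁻ x, (φ x).exp = B
  by_cases hA : A = ⊤
  · simp [hA]
  by_cases hB : B = ⊤
  · simp [hB]
  lift A to NNReal using hA
  lift B to NNReal using hB
  have : (M : EReal) - ((A : ℝ≥0∞) : EReal) - ((B : ℝ≥0∞) : EReal) = ((M - A - B : ℝ) : EReal) := rfl
  rw [this, EReal.coe_le_coe_iff, ← ENNReal.coe_add, ENNReal.le_ofReal_iff_toReal_le (by simp)
    (by linarith)]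
  simp only [ENNReal.coe_toReal, NNReal.coe_add]
  constructor <;> intro h <;> linarith

/-! ### Exponentials and closed proper concave functions -/

lemma measurable_expFun {φ : ℝ → EReal} (h : Measurable φ) : Measurable (expFun φ) :=
  (h.ereal_exp).ennreal_toReal

lemma expFun_nonneg (φ : ℝ → EReal) (x : ℝ) : 0 ≤ expFun φ x := ENNReal.toReal_nonneg

lemma ofReal_expFun {φ : ℝ → EReal} {x : ℝ} (h : φ x < ⊤) :
    ENNReal.ofReal (expFun φ x) = (φ x).exp :=
  ENNReal.ofReal_toReal (EReal.exp_lt_top_iff.2 h).ne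

lemma expFun_coe {φ : ℝ → EReal} {x a : ℝ} (h : φ x = a) : expFun φ x = Real.exp a := by
  simp [expFun, h, (Real.exp_pos a).le]

lemma expFun_bot {φ : ℝ → EReal} {x : ℝ} (h : φ x = ⊥) : expFun φ x = 0 := by
  simp [expFun, h]

lemma exp_le_ofReal {y : EReal} {a : ℝ} (h : y ≤ a) : y.exp ≤ ENNReal.ofReal (Real.exp a) := by
  rw [← EReal.exp_coe]; exact EReal.exp_monotone h

lemma ofReal_le_exp {y : EReal} {a : ℝ} (h : (a : EReal) ≤ y) :
    ENNReal.ofReal (Real.exp a) ≤ y.exp := by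
  rw [← EReal.exp_coe]; exact EReal.exp_monotone h

lemma expFun_le {φ : ℝ → EReal} {x a : ℝ} (h : φ x ≤ a) : expFun φ x ≤ Real.exp a :=
  ENNReal.toReal_le_of_le_ofReal (Real.exp_pos a).le (exp_le_ofReal h)

lemma expFun_pos_iff {φ : ℝ → EReal} {x : ℝ} (h : φ x < ⊤) : 0 < expFun φ x ↔ φ x ≠ ⊥ := by
  unfold expFun
  rw [ENNReal.toReal_pos_iff, EReal.zero_lt_exp_iff, EReal.exp_lt_top_iff, bot_lt_iff_ne_bot]
  exact and_iff_left h

lemma tendsto_expFun {ι : Type*} {l : Filter ι} {φ : ι → ℝ → EReal} {ψ : ℝ → EReal} {x : ℝ}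
    (hψ : ψ x < ⊤) (h : Tendsto (fun n => φ n x) l (𝓝 (ψ x))) :
    Tendsto (fun n => expFun (φ n) x) l (𝓝 (expFun ψ x)) :=
  (ENNReal.tendsto_toReal (EReal.exp_lt_top_iff.2 hψ).ne).comp
    ((ENNReal.continuous_exp.tendsto _).comp h)

lemma exists_coe_le {y : EReal} (h : y ≠ ⊥) : ∃ a : ℝ, (a : EReal) ≤ y :=
  (EReal.lt_iff_exists_real_btwn.1 (bot_lt_iff_ne_bot.2 h)).imp fun _ h => h.2.le

lemma ClosedProperConcave.le_apply {φ : ℝ → EReal} (h : ClosedProperConcave φ) {x y a b s : ℝ}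
    (hx : (a : EReal) ≤ φ x) (hy : (b : EReal) ≤ φ y) (h0 : 0 ≤ s) (h1 : s ≤ 1) :
    (((1 - s) * a + s * b : ℝ) : EReal) ≤ φ ((1 - s) * x + s * y) := by
  have := h.convex_hypograph (x := (x, a)) hx (y := (y, b)) hy (a := 1 - s) (b := s)
    (by linarith) h0 (by ring)
  simpa using this

lemma ClosedProperConcave.measurable {φ : ℝ → EReal} (h : ClosedProperConcave φ) :
    Measurable φ := h.upperSemicontinuous.measurable

lemma ClosedProperConcave.exists_coe {φ : ℝ → EReal} (h : ClosedProperConcave φ) {x : ℝ}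
    (hx : φ x ≠ ⊥) : ∃ a : ℝ, φ x = a :=
  ⟨(φ x).toReal, (EReal.coe_toReal (h.lt_top x).ne hx).symm⟩

lemma ClosedProperConcave.convex_dom {φ : ℝ → EReal} (h : ClosedProperConcave φ) :
    Convex ℝ (dom φ) := by
  intro x hx y hy a b ha hb hab
  obtain ⟨u, hu⟩ := exists_coe_le hx
  obtain ⟨v, hv⟩ := exists_coe_le hy
  have := h.le_apply hu hv hb (by linarith)
  obtain rfl : a = 1 - b := by linarith
  exact ne_of_gt ((EReal.bot_lt_coe _).trans_le this)

/-- Composition with an affine bijection preserves the class of closed proper concave functions. -/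
lemma ClosedProperConcave.comp_affine {φ : ℝ → EReal} (h : ClosedProperConcave φ) {m : ℝ}
    (hm : m ≠ 0) (t : ℝ) : ClosedProperConcave fun x => φ (m * x + t) where
  convex_hypograph := by
    intro p hp q hq a b ha hb hab
    have := h.le_apply hp hq hb (by linarith)
    obtain rfl : a = 1 - b := by linarith
    simp only [Set.mem_ofPred_eq, Prod.fst_add, Prod.smul_fst, smul_eq_mul, Prod.snd_add,
      Prod.smul_snd]
    convert! this using 2
    ring
  lt_top x := h.lt_top _
  exists_ne_bot := by
    obtain ⟨x, hx⟩ := h.exists_ne_bot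
    refine ⟨(x - t) / m, ?_⟩
    have : m * ((x - t) / m) + t = x := by field_simp; ring
    rwa [this]
  upperSemicontinuous := h.upperSemicontinuous.comp (g := fun x => m * x + t) (by fun_prop)

lemma ClosedProperConcave.comp_sub {φ : ℝ → EReal} (h : ClosedProperConcave φ) (t : ℝ) :
    ClosedProperConcave fun x => φ (x - t) := by
  simpa [sub_eq_add_neg] using h.comp_affine one_ne_zero (-t)

lemma ClosedProperConcave.comp_add {φ : ℝ → EReal} (h : ClosedProperConcave φ) (t : ℝ) :
    ClosedProperConcave fun x => φ (x + t) := by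
  simpa using h.comp_affine one_ne_zero t

lemma ClosedProperConcave.comp_neg {φ : ℝ → EReal} (h : ClosedProperConcave φ) :
    ClosedProperConcave fun x => φ (-x) := by
  simpa using h.comp_affine (neg_ne_zero.2 one_ne_zero) 0

lemma ClosedProperConcave.add_const {φ : ℝ → EReal} (h : ClosedProperConcave φ) (c : ℝ) :
    ClosedProperConcave fun x => φ x + c where
  convex_hypograph := by
    have key : ∀ (a : ℝ) (y : EReal), (a : EReal) ≤ y + c ↔ ((a - c : ℝ) : EReal) ≤ y := by
      intro a y
      rw [EReal.coe_sub, EReal.sub_le_iff_le_add] <;> simp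
    intro p hp q hq a b ha hb hab
    have := h.le_apply ((key _ _).1 hp) ((key _ _).1 hq) hb (by linarith)
    obtain rfl : a = 1 - b := by linarith
    simp only [Set.mem_ofPred_eq, Prod.fst_add, Prod.smul_fst, smul_eq_mul, Prod.snd_add,
      Prod.smul_snd]
    rw [key]
    convert! this using 2
    ring
  lt_top x := EReal.add_lt_top (h.lt_top x).ne (EReal.coe_ne_top c)
  exists_ne_bot := by
    obtain ⟨x, hx⟩ := h.exists_ne_bot
    exact ⟨x, by simp [EReal.add_eq_bot_iff, hx]⟩
  upperSemicontinuous := by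
    intro x t ht
    have key : ∀ y : EReal, y + c < t ↔ y < t - c := by
      intro y
      rw [EReal.lt_sub_iff_add_lt] <;> simp
    filter_upwards [h.upperSemicontinuous x (t - c) ((key _).1 ht)] with y hy
    exact (key _).2 hy

/-! ### Symmetric concave functions: monotonicity, tents, uniqueness of the centre -/

lemma SymmAbout.neg {β : Type*} {f : ℝ → β} (h : SymmAbout 0 f) (x : ℝ) : f (-x) = f x := by
  simpa using (h x).symm

lemma SymmAbout.abs {β : Type*} {f : ℝ → β} (h : SymmAbout 0 f) (x : ℝ) : f |x| = f x := by
  rcases abs_choice x with hx | hx <;> rw [hx]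
  exact h.neg x

/-- The point `|x|` is a convex combination of `-|y|` and `|y|`, where `ψ` takes equal values; the
weight of `|y|` is `(1 + |x| / |y|) / 2`. -/
lemma SC.apply_le_of_abs_le {ψ : ℝ → EReal} (h : SC 0 ψ) {x y : ℝ} (hxy : |x| ≤ |y|) :
    ψ y ≤ ψ x := by
  rcases eq_or_ne y 0 with rfl | hy
  · have : x = 0 := by simpa using hxy
    rw [this]
  have hy' : 0 < |y| := abs_pos.2 hy
  refine EReal.ge_of_forall_gt_iff_ge.1 fun a ha => ?_
  rw [← h.2.abs] at ha
  have ha' : (a : EReal) ≤ ψ (-|y|) := by rw [h.2.neg]; exact ha.le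
  have hs := (div_le_one hy').2 hxy
  have hs0 : 0 ≤ |x| / |y| := by positivity
  have := h.1.le_apply ha' ha.le (s := (1 + |x| / |y|) / 2) (by positivity) (by linarith)
  rw [← h.2.abs x]
  convert! this using 2
  · ring
  · field_simp
    ring

lemma SC.apply_le_zero {ψ : ℝ → EReal} (h : SC 0 ψ) (x : ℝ) : ψ x ≤ ψ 0 :=
  h.apply_le_of_abs_le (by simp)

lemma SC.exists_apply_zero {ψ : ℝ → EReal} (h : SC 0 ψ) : ∃ M : ℝ, ψ 0 = M := by
  obtain ⟨x, hx⟩ := h.1.exists_ne_bot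
  exact h.1.exists_coe fun h0 => hx (le_bot_iff.1 (h0 ▸ h.apply_le_zero x))

/-- A symmetric concave function that drops by `d` between `0` and `R` lies below a tent. -/
lemma SC.le_tent {ψ : ℝ → EReal} (h : SC 0 ψ) {M R d : ℝ} (hM : ψ 0 = M) (hR : 0 < R) (hd : 0 ≤ d)
    (hdrop : ψ R ≤ ((M - d : ℝ) : EReal)) (x : ℝ) :
    ψ x ≤ ((M + d - d / R * |x| : ℝ) : EReal) := by
  rcases le_total |x| R with hx | hx
  · refine (h.apply_le_zero x).trans ?_
    rw [hM, EReal.coe_le_coe_iff]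
    have : d / R * |x| ≤ d / R * R := by gcongr
    rw [div_mul_cancel₀ _ hR.ne'] at this
    linarith
  · have hx0 : 0 < |x| := hR.trans_le hx
    rw [← h.2.abs]
    refine EReal.ge_of_forall_gt_iff_ge.1 fun a ha => ?_
    -- `R` is the convex combination of `0` and `|x|` with weight `R / |x|`, so a drop of `d` at `R`
    -- forces a drop of at least `d |x| / R` at `x`.
    have h1 := h.1.le_apply hM.ge ha.le (s := R / |x|) (by positivity) ((div_le_one hx0).2 hx)
    have h2 : (1 - R / |x|) * 0 + R / |x| * |x| = R := by field_simp; ring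
    rw [h2] at h1
    have h3 := h1.trans hdrop
    rw [EReal.coe_le_coe_iff] at h3 ⊢
    have h4 : d ≤ R / |x| * (M - a) := by linarith
    have h5 : d / R * |x| ≤ M - a := by
      have := mul_le_mul_of_nonneg_left h4 (show 0 ≤ |x| / R by positivity)
      field_simp at this ⊢
      linarith
    linarith

/-- Monotonicity in `|x|` keeps `ψ ≥ a` on `[-R, R]`, so a rectangle of height `e^a` fits under
`e^ψ`. -/
lemma SC.ofReal_mul_le_lintegral_exp {ψ : ℝ → EReal} (h : SC 0 ψ) {R a : ℝ}
    (ha : (a : EReal) ≤ ψ R) :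
    ENNReal.ofReal (2 * R * Real.exp a) ≤ ∫⁻ x, (ψ x).exp := by
  rcases le_total R 0 with hR | hR
  · rw [ENNReal.ofReal_of_nonpos]
    · exact zero_le
    · have := Real.exp_pos a
      nlinarith
  calc ENNReal.ofReal (2 * R * Real.exp a)
      = ∫⁻ x in Set.Icc (-R) R, ENNReal.ofReal (Real.exp a) := by
        rw [setLIntegral_const, Real.volume_Icc, ← ENNReal.ofReal_mul (Real.exp_pos a).le]
        congr 1; ring
    _ ≤ ∫⁻ x in Set.Icc (-R) R, (ψ x).exp := by
        refine setLIntegral_mono' measurableSet_Icc fun x hx => ofReal_le_exp (ha.trans ?_)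
        refine h.apply_le_of_abs_le ?_
        rw [abs_of_nonneg hR]
        exact abs_le.2 hx
    _ ≤ ∫⁻ x, (ψ x).exp := setLIntegral_le_lintegral _ _

lemma lintegral_exp_comp_sub (ψ : ℝ → EReal) (θ : ℝ) :
    ∫⁻ x, (ψ (x - θ)).exp = ∫⁻ x, (ψ x).exp :=
  lintegral_sub_right_eq_self (fun x => (ψ x).exp) θ

/-- If `∫ e^ψ ≤ C`, then `ψ` drops by `1` below any lower bound `c` for its maximum at a point
depending only on `c` and `C`. -/
lemma SC.exists_drop (c C : ℝ) : ∃ R > 0, ∀ ψ : ℝ → EReal, SC 0 ψ →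
    ∫⁻ x, (ψ x).exp ≤ ENNReal.ofReal C → ψ R ≤ ((c - 1 : ℝ) : EReal) := by
  have he := Real.exp_pos (c - 1)
  -- With this `R` the rectangle of height `e^(c-1)` over `[-R, R]` has area `2(|C| + 1)`, which
  -- exceeds `C`.
  refine ⟨(|C| + 1) / Real.exp (c - 1), by positivity, fun ψ h hC => ?_⟩
  by_contra! hlt
  have h1 := (h.ofReal_mul_le_lintegral_exp hlt.le).trans hC
  have h2 : 2 * ((|C| + 1) / Real.exp (c - 1)) * Real.exp (c - 1) = 2 * (|C| + 1) := by
    field_simp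
  rw [h2, ENNReal.ofReal_le_ofReal_iff'] at h1
  have := le_abs_self C
  have := abs_nonneg C
  rcases h1 with h1 | h1 <;> linarith

/-- The reflections about `0` and `τ` compose to the translation by `2τ`, so `ψ` would return to its
maximum at every multiple of `2τ`; integrability of `e^ψ` makes it drop far out. -/
lemma SC.eq_zero_of_symmAbout {ψ : ℝ → EReal} (h : SC 0 ψ) (hI : ∫⁻ x, (ψ x).exp ≠ ⊤) {τ : ℝ}
    (hτ : SymmAbout τ ψ) : τ = 0 := by
  by_contra hne
  obtain ⟨M, hM⟩ := h.exists_apply_zero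
  have hper : ∀ n : ℕ, ψ (n * (2 * τ)) = ψ 0 := by
    intro n
    induction n with
    | zero => simp
    | succ n ih =>
      rw [← ih, ← h.2.neg (n * (2 * τ))]
      have := hτ (n * (2 * τ) + τ)
      push_cast
      convert! this using 2 <;> ring
  obtain ⟨R, hR, hdrop⟩ := SC.exists_drop M (∫⁻ x, (ψ x).exp).toReal
  have h1 := hdrop ψ h (ENNReal.ofReal_toReal hI).ge
  obtain ⟨n, hn⟩ := exists_nat_gt (R / |2 * τ|)
  have hpos : 0 < |2 * τ| := abs_pos.2 (by simpa using hne)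
  have h2 : ψ (n * (2 * τ)) ≤ ψ R := by
    refine h.apply_le_of_abs_le ?_
    rw [abs_of_pos hR, abs_mul, Nat.abs_cast]
    exact ((div_lt_iff₀ hpos).1 hn).le
  rw [hper, hM] at h2
  have := h2.trans h1
  rw [EReal.coe_le_coe_iff] at this
  linarith

/-! ### Fatou's lemma for varying measures -/

/-- The `m`-Lipschitz minorants used in Fatou's lemma for varying measures. -/
noncomputable def lipMinorant (fs : ℕ → ℝ → ℝ≥0∞) (m : ℕ) (x : ℝ) : ℝ :=
  ⨅ p : {n : ℕ // m ≤ n} × ℝ, ((min (fs p.1 p.2) m).toReal + m * |x - p.2|)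

section
variable (fs : ℕ → ℝ → ℝ≥0∞)

lemma lipMinorant_bddBelow (m : ℕ) (x : ℝ) : BddBelow (Set.range
    fun p : {n : ℕ // m ≤ n} × ℝ => ((min (fs p.1 p.2) m).toReal + m * |x - p.2|)) := by
  refine ⟨0, ?_⟩
  rintro _ ⟨p, rfl⟩
  positivity

instance (m : ℕ) : Nonempty ({n : ℕ // m ≤ n} × ℝ) := ⟨⟨m, le_rfl⟩, 0⟩

lemma lipMinorant_nonneg (m : ℕ) (x : ℝ) : 0 ≤ lipMinorant fs m x :=
  le_ciInf fun p => by positivity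

lemma continuous_lipMinorant (m : ℕ) : Continuous (lipMinorant fs m) := by
  refine (LipschitzWith.of_le_add_mul (m : NNReal) fun x y => ?_).continuous
  rw [← sub_le_iff_le_add]
  refine le_ciInf fun p => ?_
  rw [sub_le_iff_le_add]
  refine (ciInf_le (lipMinorant_bddBelow fs m x) p).trans ?_
  have : |x - p.2| ≤ |x - y| + |y - p.2| := abs_sub_le _ _ _
  have h2 := mul_le_mul_of_nonneg_left this (Nat.cast_nonneg (α := ℝ) m)
  rw [Real.dist_eq, NNReal.coe_natCast]
  linarith

lemma lipMinorant_mono (x : ℝ) : Monotone fun m => lipMinorant fs m x := by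
  refine monotone_nat_of_le_succ fun m => le_ciInf fun p => ?_
  refine (ciInf_le (lipMinorant_bddBelow fs m x) ⟨⟨p.1, (Nat.le_succ m).trans p.1.2⟩, p.2⟩).trans ?_
  have h : (m : ℝ) ≤ ((m + 1 : ℕ) : ℝ) := by simp
  have h' : (m : ℝ≥0∞) ≤ ((m + 1 : ℕ) : ℝ≥0∞) := by simp
  refine add_le_add (ENNReal.toReal_mono ?_ (min_le_min_left _ h'))
    (mul_le_mul_of_nonneg_right h (abs_nonneg _))
  exact ((min_le_right _ _).trans_lt (ENNReal.natCast_lt_top _)).ne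

lemma ofReal_lipMinorant_le {m n : ℕ} (h : m ≤ n) (x : ℝ) :
    ENNReal.ofReal (lipMinorant fs m x) ≤ fs n x := by
  have := ciInf_le (lipMinorant_bddBelow fs m x) ⟨⟨n, h⟩, x⟩
  simp only [sub_self, abs_zero, mul_zero, add_zero] at this
  exact (ENNReal.ofReal_le_of_le_toReal this).trans (min_le_left _ _)

/-- Late functions exceed `t` on the `δ`-ball around `x`, and points outside it pay the penalty `m δ
≥ t`. The index `m` must also exceed `t`, so that the truncation at `m`, which keeps the infimum
real, is harmless. -/
lemma le_iSup_lipMinorant {f : ℝ → ℝ≥0∞} {x : ℝ}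
    (hf : ∀ t, t < f x → ∀ᶠ p in atTop ×ˢ 𝓝 x, t < fs p.1 p.2) :
    f x ≤ ⨆ m, ENNReal.ofReal (lipMinorant fs m x) := by
  refine le_of_forall_lt_imp_le_of_dense fun t ht => ?_
  obtain ⟨pa, hpa, pb, hpb, hp⟩ := eventually_prod_iff.1 (hf t ht)
  obtain ⟨N, hN⟩ := eventually_atTop.1 hpa
  obtain ⟨δ, hδ, hδ'⟩ := Metric.eventually_nhds_iff.1 hpb
  lift t to NNReal using (ht.trans_le le_top).ne
  obtain ⟨m, hm⟩ := exists_nat_ge (max (max (N : ℝ) t) (t / δ))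
  have hm1 : N ≤ m := by exact_mod_cast (le_max_left _ _).trans ((le_max_left _ _).trans hm)
  have hm2 : (t : ℝ) ≤ m := (le_max_right _ _).trans ((le_max_left _ _).trans hm)
  have hm3 : (t : ℝ) ≤ m * δ := (div_le_iff₀ hδ).1 ((le_max_right _ _).trans hm)
  refine le_iSup_of_le m ?_
  rw [← ENNReal.ofReal_coe_nnreal]
  refine ENNReal.ofReal_le_ofReal (le_ciInf fun p => ?_)
  rcases lt_or_ge |x - p.2| δ with h | h
  · have h1 := hp (hN p.1 (hm1.trans p.1.2)) (hδ' (y := p.2) (by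
      rw [Real.dist_eq, abs_sub_comm]; exact h))
    have h2 : (t : ℝ) ≤ (min (fs p.1 p.2) m).toReal := by
      rw [← ENNReal.coe_toReal]
      refine ENNReal.toReal_mono ((min_le_right _ _).trans_lt (ENNReal.natCast_lt_top _)).ne
        (le_min h1.le ?_)
      exact_mod_cast hm2
    have : 0 ≤ (m : ℝ) * |x - p.2| := by positivity
    linarith
  · have h1 : (m : ℝ) * δ ≤ m * |x - p.2| := by gcongr
    have : 0 ≤ (min (fs p.1 p.2) (m : ℝ≥0∞)).toReal := ENNReal.toReal_nonneg
    linarith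

end

/-- Fatou's lemma for varying measures and varying functions. -/
lemma lintegral_le_liminf_lintegral_varying {μ : Measure ℝ} {μs : ℕ → Measure ℝ}
    {f : ℝ → ℝ≥0∞} {fs : ℕ → ℝ → ℝ≥0∞}
    (hμ : ∀ G, IsOpen G → μ G ≤ liminf (fun n => μs n G) atTop)
    (hf : ∀ x t, t < f x → ∀ᶠ p in atTop ×ˢ 𝓝 x, t < fs p.1 p.2) :
    ∫⁻ x, f x ∂μ ≤ liminf (fun n => ∫⁻ x, fs n x ∂(μs n)) atTop := by
  calc ∫⁻ x, f x ∂μ ≤ ∫⁻ x, ⨆ m, ENNReal.ofReal (lipMinorant fs m x) ∂μ :=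
        lintegral_mono fun x => le_iSup_lipMinorant fs (hf x)
    _ = ⨆ m, ∫⁻ x, ENNReal.ofReal (lipMinorant fs m x) ∂μ := by
        refine lintegral_iSup (fun m => ?_) fun m n hmn x => ?_
        · exact (continuous_lipMinorant fs m).measurable.ennreal_ofReal
        · exact ENNReal.ofReal_le_ofReal (lipMinorant_mono fs x hmn)
    _ ≤ liminf (fun n => ∫⁻ x, fs n x ∂(μs n)) atTop := by
        -- For fixed `m` the minorant is one continuous function, so the open-set criterion applies
        -- to it; it lies below `fs n` for all `n ≥ m`.
        refine iSup_le fun m => ?_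
        refine (lintegral_le_liminf_lintegral_of_forall_isOpen_measure_le_liminf_measure
          (continuous_lipMinorant fs m) (lipMinorant_nonneg fs m) hμ).trans ?_
        refine liminf_le_liminf ?_
        filter_upwards [eventually_ge_atTop m] with n hn
        exact lintegral_mono fun x => ofReal_lipMinorant_le fs hn x

/-! ### A priori bounds from a lower bound on the criterion -/

/-- A measure that is not concentrated at a point has two disjoint neighbourhoods of positive mass;
hence so have, uniformly, the measures of a converging sequence outside short intervals. -/
lemma exists_mass_outside {μ : Measure ℝ} (hμ : ∀ a, μ {a}ᶜ ≠ 0) :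
    ∃ r > 0, ∃ δ > 0, ∀ μs : ℕ → Measure ℝ,
      (∀ G, IsOpen G → μ G ≤ liminf (fun n => μs n G) atTop) →
      ∀ᶠ n in atTop, ∀ θ : ℝ, ENNReal.ofReal δ ≤ μs n {x | r < |x - θ|} := by
  -- If every point had a null neighbourhood, the measure would vanish by the Lindelöf property. The
  -- same argument on the complement of `p` produces `q`.
  have h1 : ∃ p, ∀ u ∈ 𝓝 p, μ u ≠ 0 := by
    by_contra! h
    refine hμ 0 (measure_mono_null (Set.subset_univ _) ?_)
    refine measure_null_of_locally_null _ fun x _ => ?_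
    simpa using h x
  obtain ⟨p, hp⟩ := h1
  have h2 : ∃ q ∈ ({p}ᶜ : Set ℝ), ∀ u ∈ 𝓝[{p}ᶜ] q, μ u ≠ 0 := by
    by_contra! h
    exact hμ p (measure_null_of_locally_null _ fun x hx => h x hx)
  obtain ⟨q, hqp, hq⟩ := h2
  have hd : 0 < |p - q| := abs_pos.2 (sub_ne_zero.2 (Ne.symm hqp))
  set d := |p - q| with hdef
  have hp' := hp _ (Metric.ball_mem_nhds p (show 0 < d / 8 by positivity))
  have hq' := hq _ (mem_nhdsWithin_of_mem_nhds
    (Metric.ball_mem_nhds q (show 0 < d / 8 by positivity)))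
  obtain ⟨δ, hδ0, hδ⟩ := ENNReal.lt_iff_exists_nnreal_btwn.1
    (lt_min (pos_iff_ne_zero.2 hp') (pos_iff_ne_zero.2 hq'))
  refine ⟨d / 4, by positivity, δ, by exact_mod_cast hδ0, fun μs hs => ?_⟩
  have e1 := eventually_lt_of_lt_liminf
    ((hδ.trans_le (min_le_left _ _)).trans_le (hs _ Metric.isOpen_ball))
  have e2 := eventually_lt_of_lt_liminf
    ((hδ.trans_le (min_le_right _ _)).trans_le (hs _ Metric.isOpen_ball))
  filter_upwards [e1, e2] with n hn1 hn2 θ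
  rw [ENNReal.ofReal_coe_nnreal]
  -- A centre `θ` within `d / 2` of `p` is at distance at least `d / 2` from `q`. In either case a
  -- ball of radius `d / 8` stays further than `d / 4` from `θ`.
  by_cases hθ : |p - θ| ≤ d / 2
  · refine hn2.le.trans (measure_mono fun x hx => ?_)
    rw [Metric.mem_ball, Real.dist_eq] at hx
    have e3 := abs_sub_le p θ q
    have e4 := abs_sub_le θ x q
    rw [abs_sub_comm θ x] at e4
    change d / 4 < |x - θ|
    linarith
  · refine hn1.le.trans (measure_mono fun x hx => ?_)
    rw [Metric.mem_ball, Real.dist_eq] at hx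
    have e3 := abs_sub_le p x θ
    rw [abs_sub_comm p x] at e3
    change d / 4 < |x - θ|
    linarith

/-- Replacing `φ` by its majorant `v` in the linear term only leaves `c ≤ ∫ v - ∫ e^φ`. Every later
bound comes from a suitable choice of `v`. -/
lemma le_integral_of_le_omega {φ : ℝ → EReal} {v : ℝ → ℝ} {μ : Measure ℝ} {c : ℝ}
    (hv : Integrable v μ) (hφ : ∀ x, φ x ≤ v x) (hc : (c : EReal) ≤ omega φ μ) :
    c ≤ ∫ x, v x ∂μ ∧ ∫⁻ x, (φ x).exp ≤ ENNReal.ofReal (∫ x, v x ∂μ - c) := by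
  have h1 : (c : EReal) ≤ ((∫ x, v x ∂μ : ℝ) : EReal) - ((∫⁻ x, (φ x).exp : ℝ≥0∞) : EReal) := by
    refine hc.trans (EReal.sub_le_sub ?_ le_rfl)
    rw [← eintegral_coe hv]
    exact eintegral_mono μ hφ
  have hI : ∫⁻ x, (φ x).exp ≠ ⊤ := by
    intro h
    rw [h] at h1
    simp at h1
  lift ∫⁻ x, (φ x).exp to NNReal using hI with I
  have h2 : ((∫ x, v x ∂μ : ℝ) : EReal) - ((I : ℝ≥0∞) : EReal) = ((∫ x, v x ∂μ - I : ℝ) : EReal) :=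
    rfl
  rw [h2, EReal.coe_le_coe_iff] at h1
  have := I.2
  have h3 : (I : ℝ) ≤ ∫ x, v x ∂μ - c := by linarith
  refine ⟨by linarith [I.coe_nonneg], ?_⟩
  rw [← ENNReal.ofReal_coe_nnreal]
  exact ENNReal.ofReal_le_ofReal h3

/-- A lower bound on the criterion bounds the maximum of `ψ`, uniformly over measures that are not
concentrated on short intervals. -/
lemma exists_apply_zero_le (c : ℝ) {r δ : ℝ} (hr : 0 < r) (hδ : 0 < δ) :
    ∃ B > 0, ∀ (μ : Measure ℝ) [IsProbabilityMeasure μ] (θ : ℝ) (ψ : ℝ → EReal),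
      ENNReal.ofReal δ ≤ μ {x | r < |x - θ|} → SC 0 ψ → (c : EReal) ≤ Psi θ ψ μ → ψ 0 ≤ (B : ℝ) := by
  set a : ℝ := 2 / δ with ha
  have ha0 : 0 < a := by positivity
  set κ : ℝ := r / (1 + a) with hκ
  have hκ0 : 0 < κ := by positivity
  refine ⟨|c| + 16 / κ, by positivity, fun μ _ θ ψ hS hψ hc => ?_⟩
  obtain ⟨M, hM⟩ := hψ.exists_apply_zero
  rw [hM, EReal.coe_le_coe_iff]
  by_contra! hlt
  have h16 : 0 < 16 / κ := by positivity
  have hM0 : 0 < M := by linarith [abs_nonneg c]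
  have hMc : -c < M := by linarith [neg_abs_le c]
  -- If `ψ(r) ≤ -aM`, the mass `δ` beyond distance `r` costs `δ(1 + a)M = δM + 2M`, so the linear
  -- term is below `-M < c`. Otherwise `ψ` stays high near `0` and `∫ e^ψ` is too large.
  by_cases hr' : ψ r ≤ ((-a * M : ℝ) : EReal)
  · set S : Set ℝ := {x | r < |x - θ|} with hSdef
    have hSm : MeasurableSet S := by
      apply measurableSet_lt <;> fun_prop
    set v : ℝ → ℝ := fun x => M + S.indicator (fun _ => -((1 + a) * M)) x with hv
    have hi : Integrable (S.indicator fun _ => -((1 + a) * M)) μ :=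
      (integrable_const _).indicator hSm
    have hvi : Integrable v μ := (integrable_const M).add hi
    have hle : ∀ x, ψ (x - θ) ≤ v x := by
      intro x
      by_cases hx : x ∈ S
      · have : v x = -a * M := by simp [hv, hx]; ring
        rw [this]
        refine le_trans (hψ.apply_le_of_abs_le ?_) hr'
        rw [abs_of_pos hr]
        exact le_of_lt hx
      · have : v x = M := by simp [hv, hx]
        rw [this, ← hM]
        exact hψ.apply_le_zero _
    have h1 := (le_integral_of_le_omega hvi hle hc).1
    have h2 : ∫ x, v x ∂μ = M + μ.real S * (-((1 + a) * M)) := by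
      rw [hv, integral_add (integrable_const M) hi, integral_indicator hSm]
      simp
    have h3 : δ ≤ μ.real S := by
      have := ENNReal.toReal_mono (measure_ne_top μ S) hS
      rwa [ENNReal.toReal_ofReal hδ.le] at this
    have h4 : δ * ((1 + a) * M) ≤ μ.real S * ((1 + a) * M) := by gcongr
    have h5 : δ * ((1 + a) * M) = δ * M + 2 * M := by
      rw [ha]; field_simp
    have : 0 < δ * M := by positivity
    rw [h2] at h1
    linarith
  · push Not at hr'
    -- This weight halves the drop bound: `ψ(κ / 2) ≥ M / 2`. Hence `∫ e^ψ ≥ κ e^(M/2) ≥ κ M² / 8`,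
    -- which exceeds `2M > M - c` because `κ M > 16`.
    have h1 := hψ.1.le_apply hM.ge hr'.le (s := 1 / (2 * (1 + a))) (by positivity)
      (by rw [div_le_one (by positivity)]; linarith)
    have h2 : (1 - 1 / (2 * (1 + a))) * 0 + 1 / (2 * (1 + a)) * r = κ / 2 := by
      rw [hκ]; field_simp; ring
    have h3 : (1 - 1 / (2 * (1 + a))) * M + 1 / (2 * (1 + a)) * (-a * M) = M / 2 := by
      field_simp; ring
    rw [h2, h3] at h1
    have h4 := hψ.ofReal_mul_le_lintegral_exp h1
    have h5 := (le_integral_of_le_omega (v := fun _ => M) (integrable_const M)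
      (fun x => hM ▸ hψ.apply_le_zero (x - θ)) hc).2
    rw [lintegral_exp_comp_sub] at h5
    have h6 := h4.trans h5
    simp only [integral_const, probReal_univ, smul_eq_mul, one_mul] at h6
    rw [ENNReal.ofReal_le_ofReal_iff'] at h6
    have hexp : (M / 2) ^ 2 / 2 ≤ Real.exp (M / 2) := by
      have := Real.quadratic_le_exp_of_nonneg (show 0 ≤ M / 2 by positivity)
      nlinarith
    have hpos : 0 < 2 * (κ / 2) * Real.exp (M / 2) := by positivity
    rcases h6 with h6 | h6
    · have h7 : 16 < κ * M := by
        have : 16 / κ < M := by linarith [abs_nonneg c]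
        rwa [div_lt_iff₀ hκ0, mul_comm] at this
      have h8 : κ * ((M / 2) ^ 2 / 2) ≤ κ * Real.exp (M / 2) := by gcongr
      have h9 : 16 * M ≤ κ * M * M := by gcongr
      nlinarith
    · linarith

/-! ### Compactness of symmetric concave functions -/

/-- Convergence of symmetric concave functions: the upper bound holds along moving points, the lower
bound pointwise in the interior of the limiting domain. -/
def HypoTendsto (ψs : ℕ → ℝ → EReal) (ψ : ℝ → EReal) : Prop :=
  (∀ x t, ψ x < t → ∀ᶠ p in atTop ×ˢ 𝓝 x, ψs p.1 p.2 < t) ∧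
    ∀ x ∈ interior (dom ψ), ∀ t, t < ψ x → ∀ᶠ n in atTop, t < ψs n x

section limit
variable {u : ℕ → ℝ → EReal}

lemma le_liminf_of_concave (hu : ∀ n, SC 0 (u n)) {x y a b s : ℝ}
    (hx : (a : EReal) ≤ liminf (fun n => u n x) atTop)
    (hy : (b : EReal) ≤ liminf (fun n => u n y) atTop) (h0 : 0 ≤ s) (h1 : s ≤ 1) :
    (((1 - s) * a + s * b : ℝ) : EReal) ≤ liminf (fun n => u n ((1 - s) * x + s * y)) atTop := by
  refine EReal.ge_of_forall_gt_iff_ge.1 fun t ht => ?_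
  rw [EReal.coe_lt_coe_iff] at ht
  obtain ⟨ε, hε⟩ : ∃ ε, ε = (1 - s) * a + s * b - t := ⟨_, rfl⟩
  have ha : ((a - ε : ℝ) : EReal) < a := by rw [EReal.coe_lt_coe_iff]; linarith
  have hb : ((b - ε : ℝ) : EReal) < b := by rw [EReal.coe_lt_coe_iff]; linarith
  refine le_liminf_of_le (by isBoundedDefault) ?_
  filter_upwards [eventually_lt_of_lt_liminf (ha.trans_le hx),
    eventually_lt_of_lt_liminf (hb.trans_le hy)] with n hn1 hn2
  have := (hu n).1.le_apply hn1.le hn2.le h0 h1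
  convert! this using 2
  rw [hε]; ring

lemma liminf_le_of_abs_le (hu : ∀ n, SC 0 (u n)) {x y : ℝ} (hxy : |x| ≤ |y|) :
    liminf (fun n => u n y) atTop ≤ liminf (fun n => u n x) atTop :=
  liminf_le_liminf (Eventually.of_forall fun n => (hu n).apply_le_of_abs_le hxy)

/-- The closure of the pointwise lower limit. -/
noncomputable def closureLiminf (u : ℕ → ℝ → EReal) (x : ℝ) : EReal :=
  ⨅ s : Set.Ico (0 : ℝ) 1, liminf (fun n => u n (s * x)) atTop

lemma closureLiminf_le {s : ℝ} (hs : s ∈ Set.Ico (0 : ℝ) 1) (x : ℝ) :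
    closureLiminf u x ≤ liminf (fun n => u n (s * x)) atTop :=
  iInf_le (fun s : Set.Ico (0 : ℝ) 1 => liminf (fun n => u n (s * x)) atTop) ⟨s, hs⟩

lemma closureLiminf_zero : closureLiminf u 0 = liminf (fun n => u n 0) atTop := by
  have : Nonempty (Set.Ico (0 : ℝ) 1) := ⟨⟨0, by simp⟩⟩
  simp [closureLiminf]

lemma closureLiminf_lt_iff {x : ℝ} {t : EReal} :
    closureLiminf u x < t ↔ ∃ s ∈ Set.Ico (0 : ℝ) 1, liminf (fun n => u n (s * x)) atTop < t := by
  simp [closureLiminf, iInf_lt_iff]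

lemma closureLiminf_le_zero (x : ℝ) : closureLiminf u x ≤ liminf (fun n => u n 0) atTop := by
  simpa using closureLiminf_le (u := u) (s := 0) (by simp) x

lemma eventually_mul_abs_lt {x s : ℝ} (hx : x ≠ 0) (hs : s < 1) : ∀ᶠ y in 𝓝 x, s * |x| < |y| := by
  have h : s * |x| < |x| := by nlinarith [abs_pos.2 hx]
  exact (continuous_abs.tendsto x).eventually (lt_mem_nhds h)

/-- Concavity survives lower limits. As the functions decrease in `|x|`, the upper semicontinuous
hull is obtained along rays, by the infimum over contractions `s x` with `s < 1`. The bounds at `0`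
keep the limit proper. -/
lemma sc_closureLiminf (hu : ∀ n, SC 0 (u n)) {c B : ℝ} (hc : ∀ n, (c : EReal) ≤ u n 0)
    (hB : ∀ n, u n 0 ≤ B) : SC 0 (closureLiminf u) := by
  have h0top : liminf (fun n => u n 0) atTop ≤ B :=
    liminf_le_of_le (f := atTop) (by isBoundedDefault) fun b hb => by
      obtain ⟨n, hn⟩ := hb.exists
      exact hn.trans (hB n)
  have h0bot : (c : EReal) ≤ liminf (fun n => u n 0) atTop :=
    le_liminf_of_le (f := atTop) (by isBoundedDefault) (Eventually.of_forall hc)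
  refine ⟨⟨?_, ?_, ?_, ?_⟩, ?_⟩
  · intro p hp q hq a b ha hb hab
    simp only [Set.mem_ofPred_eq, closureLiminf, le_iInf_iff]
    intro s
    have h1 := le_liminf_of_concave hu (le_trans hp (closureLiminf_le s.2 p.1))
      (le_trans hq (closureLiminf_le s.2 q.1)) hb (by linarith)
    obtain rfl : a = 1 - b := by linarith
    simp only [Prod.fst_add, Prod.smul_fst, smul_eq_mul, Prod.snd_add, Prod.smul_snd]
    convert! h1 using 4
    ring_nf
  · intro x
    exact ((closureLiminf_le_zero x).trans h0top).trans_lt (EReal.coe_lt_top B)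
  · refine ⟨0, ne_of_gt ?_⟩
    rw [closureLiminf_zero]
    exact (EReal.bot_lt_coe c).trans_le h0bot
  · intro x t ht
    rcases eq_or_ne x 0 with rfl | hx
    · rw [closureLiminf_zero] at ht
      exact Eventually.of_forall fun y => (closureLiminf_le_zero y).trans_lt ht
    · obtain ⟨s, hs, hst⟩ := closureLiminf_lt_iff.1 ht
      -- If `|y|` exceeds `2s / (1 + s) · |x|`, then contracting `y` by the admissible factor `(1 +
      -- s) / 2` still leaves it at least as far out as `s x`.
      have hs1 : 2 * s / (1 + s) < 1 := by
        rw [div_lt_one (by linarith [hs.1])]; linarith [hs.2]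
      filter_upwards [eventually_mul_abs_lt hx hs1] with y hy
      refine lt_of_le_of_lt ?_ hst
      refine (closureLiminf_le (s := (1 + s) / 2) ⟨by linarith [hs.1], by linarith [hs.2]⟩ y).trans ?_
      refine liminf_le_of_abs_le hu ?_
      have hs0 : 0 < 1 + s := by linarith [hs.1]
      rw [abs_mul, abs_mul, abs_of_nonneg hs.1, abs_of_pos (by linarith : 0 < (1 + s) / 2)]
      have := mul_lt_mul_of_pos_left hy (show 0 < (1 + s) / 2 by linarith)
      refine le_trans (le_of_eq ?_) this.le
      field_simp
  · intro x
    simp only [closureLiminf, zero_add, zero_sub, mul_neg]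
    exact iInf_congr fun s => by simp only [(hu _).2.neg]

/-- Genuine limits at rational points turn a statement about a lower limit into one about all late
`n`: a rational radius `q` between `s|x|` and `|x|` controls, by monotonicity, all points near `x`.
The lower bound uses concavity along the ray through `x`, where an interior point leaves room. -/
lemma hypoTendsto_closureLiminf (hu : ∀ n, SC 0 (u n)) {H : ℚ → EReal}
    (hH : ∀ q : ℚ, Tendsto (fun n => u n q) atTop (𝓝 (H q))) :
    HypoTendsto u (closureLiminf u) := by
  constructor
  · intro x t ht
    rcases eq_or_ne x 0 with rfl | hx
    · rw [closureLiminf_zero] at ht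
      have h0 := hH 0
      rw [Rat.cast_zero] at h0
      rw [h0.liminf_eq] at ht
      have := (h0.eventually (gt_mem_nhds ht)).prod_inl (𝓝 (0 : ℝ))
      exact this.mono fun p hp => ((hu p.1).apply_le_zero p.2).trans_lt hp
    · obtain ⟨s, hs, hst⟩ := closureLiminf_lt_iff.1 ht
      have hx' : s * |x| < |x| := by nlinarith [abs_pos.2 hx, hs.2]
      obtain ⟨q, hq1, hq2⟩ := exists_rat_btwn hx'
      have hq0 : (0 : ℝ) ≤ q := le_trans (mul_nonneg hs.1 (abs_nonneg x)) hq1.le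
      have h1 : H q < t := by
        rw [← (hH q).liminf_eq]
        refine lt_of_le_of_lt (liminf_le_of_abs_le hu ?_) hst
        rw [abs_mul, abs_of_nonneg hs.1, abs_of_nonneg hq0]
        exact hq1.le
      have h2 : ∀ᶠ y in 𝓝 x, (q : ℝ) < |y| := (continuous_abs.tendsto x).eventually (lt_mem_nhds hq2)
      refine (((hH q).eventually (gt_mem_nhds h1)).prod_mk h2).mono fun p hp => ?_
      refine lt_of_le_of_lt ((hu p.1).apply_le_of_abs_le ?_) hp.1
      rw [abs_of_nonneg hq0]
      exact hp.2.le
  · intro x hx t ht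
    suffices h : t < liminf (fun n => u n x) atTop from eventually_lt_of_lt_liminf h
    rcases eq_or_ne x 0 with rfl | hx0
    · rwa [closureLiminf_zero] at ht
    have hcont : Tendsto (fun η : ℝ => (1 + η) * x) (𝓝[>] 0) (𝓝 x) := by
      have : Tendsto (fun η : ℝ => (1 + η) * x) (𝓝 0) (𝓝 ((1 + 0) * x)) :=
        Continuous.tendsto (by fun_prop) 0
      rw [add_zero, one_mul] at this
      exact this.mono_left nhdsWithin_le_nhds
    obtain ⟨η, hη, hη0⟩ := ((hcont.eventually (mem_interior_iff_mem_nhds.1 hx)).and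
      self_mem_nhdsWithin).exists
    obtain ⟨b, hb⟩ := exists_coe_le (y := closureLiminf u ((1 + η) * x)) hη
    obtain ⟨a', hta, ha'⟩ := EReal.lt_iff_exists_real_btwn.1 ht
    obtain ⟨a, haa, ha⟩ := EReal.lt_iff_exists_real_btwn.1 ha'
    rw [EReal.coe_lt_coe_iff] at haa
    have hlim : Tendsto (fun l : ℝ => (1 - l) * a + l * b) (𝓝[>] 0) (𝓝 a) := by
      have : Tendsto (fun l : ℝ => (1 - l) * a + l * b) (𝓝 0) (𝓝 ((1 - 0) * a + 0 * b)) :=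
        Continuous.tendsto (by fun_prop) 0
      rw [sub_zero, one_mul, zero_mul, add_zero] at this
      exact this.mono_left nhdsWithin_le_nhds
    obtain ⟨l, ⟨hl1, hl0⟩, hl⟩ := ((hlim.eventually (lt_mem_nhds haa)).and
      self_mem_nhdsWithin |>.and (nhdsWithin_le_nhds (gt_mem_nhds one_pos))).exists
    have hl0' : 0 < l := hl0
    have hη0' : 0 < η := hη0
    have hlη : 0 < l * η := mul_pos hl0' hη0'
    -- The point `x` is the convex combination with weight `l` of the contractions of `x` and `(1 +
    -- η) x` by `1 / (1 + l η)`. The resulting bound `(1 - l) a + l b` tends to `a` as `l → 0`.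
    have hs : 1 / (1 + l * η) ∈ Set.Ico (0 : ℝ) 1 :=
      ⟨by positivity, by rw [div_lt_one (by positivity)]; linarith⟩
    have h1 := le_liminf_of_concave hu (ha.le.trans (closureLiminf_le hs x))
      (hb.trans (closureLiminf_le hs _)) hl0'.le hl.le
    have h2 : (1 - l) * (1 / (1 + l * η) * x) + l * (1 / (1 + l * η) * ((1 + η) * x)) = x := by
      field_simp; ring
    rw [h2] at h1
    exact hta.trans ((EReal.coe_lt_coe_iff.2 hl1).trans_le h1)

end limit

/-- Helly selection: `EReal` is compact and `ℚ` countable, so a subsequence converges at all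
rationals. -/
lemma exists_subseq_hypoTendsto {ψs : ℕ → ℝ → EReal} (hψ : ∀ n, SC 0 (ψs n)) {c B : ℝ}
    (hc : ∀ n, (c : EReal) ≤ ψs n 0) (hB : ∀ n, ψs n 0 ≤ B) :
    ∃ (σ : ℕ → ℕ) (ψ : ℝ → EReal), StrictMono σ ∧ SC 0 ψ ∧ ψ 0 ≤ B ∧
      HypoTendsto (fun n => ψs (σ n)) ψ := by
  obtain ⟨H, σ, hσ, hH⟩ := CompactSpace.tendsto_subseq fun n => fun q : ℚ => ψs n q
  rw [tendsto_pi_nhds] at hH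
  exact ⟨σ, closureLiminf fun n => ψs (σ n), hσ,
    sc_closureLiminf (fun n => hψ _) (fun n => hc _) (fun n => hB _),
    closureLiminf_zero.trans_le (liminf_le_of_le (by isBoundedDefault) fun b hb => by
      obtain ⟨n, hn⟩ := hb.exists
      exact hn.trans (hB _)),
    hypoTendsto_closureLiminf (fun n => hψ _) hH⟩

lemma HypoTendsto.comp_tendsto {ψs : ℕ → ℝ → EReal} {ψ : ℝ → EReal} (h : HypoTendsto ψs ψ)
    {σ : ℕ → ℕ} (hσ : Tendsto σ atTop atTop) : HypoTendsto (fun n => ψs (σ n)) ψ :=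
  ⟨fun x t ht => (hσ.prodMap tendsto_id).eventually (h.1 x t ht),
    fun x hx t ht => hσ.eventually (h.2 x hx t ht)⟩

lemma HypoTendsto.eventually_lt {ψs : ℕ → ℝ → EReal} {ψ : ℝ → EReal} (h : HypoTendsto ψs ψ)
    {x : ℝ} {t : EReal} (ht : ψ x < t) : ∀ᶠ n in atTop, ψs n x < t := by
  have h2 := (h.1 x t ht)
  exact (tendsto_id.prodMk (tendsto_const_nhds (x := x))).eventually h2

lemma HypoTendsto.tendsto_of_eq_bot {ψs : ℕ → ℝ → EReal} {ψ : ℝ → EReal} (h : HypoTendsto ψs ψ)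
    {x : ℝ} (hx : ψ x = ⊥) : Tendsto (fun n => ψs n x) atTop (𝓝 (ψ x)) :=
  tendsto_order.2 ⟨fun t ht => absurd ht (by simp [hx]), fun _ ht => h.eventually_lt ht⟩

lemma HypoTendsto.tendsto {ψs : ℕ → ℝ → EReal} {ψ : ℝ → EReal} (h : HypoTendsto ψs ψ)
    {x : ℝ} (hx : x ∈ interior (dom ψ)) : Tendsto (fun n => ψs n x) atTop (𝓝 (ψ x)) :=
  tendsto_order.2 ⟨h.2 x hx, fun _ ht => h.eventually_lt ht⟩

/-- Convergence can fail only at finite boundary points of the convex set `dom ψ`, whose frontier is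
null. -/
lemma HypoTendsto.ae_tendsto {ψs : ℕ → ℝ → EReal} {ψ : ℝ → EReal} (h : HypoTendsto ψs ψ)
    (hψ : ClosedProperConcave ψ) : ∀ᵐ x, Tendsto (fun n => ψs n x) atTop (𝓝 (ψ x)) := by
  have h0 : volume (frontier (dom ψ)) = 0 := hψ.convex_dom.addHaar_frontier volume
  filter_upwards [compl_mem_ae_iff.2 h0] with x hx
  by_cases hd : ψ x = ⊥
  · exact h.tendsto_of_eq_bot hd
  · refine h.tendsto ?_
    by_contra hni
    exact hx ⟨subset_closure hd, hni⟩

/-! ### Approximating measures, upper semicontinuity, almost maximizers -/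

/-- The sequence `μs` consists eventually of probability measures with bounded first moments, and it
satisfies the open-set criterion for weak convergence to `μ`. -/
structure Approx (μs : ℕ → Measure ℝ) (μ : Measure ℝ) : Prop where
  prob : ∀ᶠ n in atTop, IsProbabilityMeasure (μs n)
  open_le : ∀ G, IsOpen G → μ G ≤ liminf (fun n => μs n G) atTop
  moment : ∃ K : ℝ, ∀ᶠ n in atTop, ∫⁻ x, ENNReal.ofReal |x| ∂(μs n) ≤ ENNReal.ofReal K

lemma Approx.comp_tendsto {μs : ℕ → Measure ℝ} {μ : Measure ℝ} (h : Approx μs μ) {σ : ℕ → ℕ}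
    (hσ : Tendsto σ atTop atTop) : Approx (fun n => μs (σ n)) μ where
  prob := hσ.eventually h.prob
  open_le G hG := (h.open_le G hG).trans hσ.liminf_le_liminf_comp
  moment := h.moment.imp fun _ hK => hσ.eventually hK

lemma approx_const {μ : Measure ℝ} [IsProbabilityMeasure μ]
    (h : ∫⁻ x, ENNReal.ofReal |x| ∂μ ≠ ⊤) : Approx (fun _ => μ) μ where
  prob := Eventually.of_forall fun _ => inferInstance
  open_le G _ := by simp
  moment := ⟨(∫⁻ x, ENNReal.ofReal |x| ∂μ).toReal, Eventually.of_forall fun _ =>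
    (ENNReal.ofReal_toReal h).ge⟩

lemma add_liminf_le {a b : ℕ → ℝ≥0∞} {C : ℝ≥0∞} (h : ∀ᶠ n in atTop, a n + b n ≤ C) :
    liminf a atTop + liminf b atTop ≤ C := by
  obtain ⟨N, hN⟩ := eventually_atTop.1 h
  rw [liminf_eq_iSup_iInf_of_nat, liminf_eq_iSup_iInf_of_nat,
    ENNReal.iSup_add_iSup_of_monotone (fun i j hij => biInf_mono fun k hk => hij.trans hk)
      (fun i j hij => biInf_mono fun k hk => hij.trans hk)]
  refine iSup_le fun n => (add_le_add (iInf₂_le (max n N) ?_) (iInf₂_le (max n N) ?_)).trans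
    (hN _ (le_max_right _ _)) <;> exact le_max_left n N

lemma lintegral_exp_le_liminf {ψs : ℕ → ℝ → EReal} {ψ : ℝ → EReal} (h : HypoTendsto ψs ψ)
    (hψs : ∀ n, Measurable (ψs n)) (hψ : ClosedProperConcave ψ) :
    ∫⁻ x, (ψ x).exp ≤ liminf (fun n => ∫⁻ x, (ψs n x).exp) atTop := by
  calc ∫⁻ x, (ψ x).exp ≤ ∫⁻ x, liminf (fun n => (ψs n x).exp) atTop := by
        refine lintegral_mono_ae ((h.ae_tendsto hψ).mono fun x hx => ?_)
        exact (((ENNReal.continuous_exp.tendsto _).comp hx).liminf_eq).ge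
    _ ≤ _ := lintegral_liminf_le fun n => (hψs n).ereal_exp

/-- From `|θ| ≤ |x - θ| + |x|` the tent gives `ψ(x - θ) ≤ B - |θ| / R + |x| / R`; integrating, a
remote centre would push the criterion below `c`. -/
lemma abs_le_of_le_Psi {μ : Measure ℝ} [IsProbabilityMeasure μ] {θ : ℝ} {ψ : ℝ → EReal}
    {c B R K : ℝ} (hR : 0 < R) (hK : ∫⁻ x, ENNReal.ofReal |x| ∂μ ≤ ENNReal.ofReal K)
    (hψ : ∀ x, ψ x ≤ ((B - 1 / R * |x| : ℝ) : EReal)) (hc : (c : EReal) ≤ Psi θ ψ μ) :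
    |θ| ≤ R * (B - c) + |K| := by
  have hi : Integrable (fun x : ℝ => |x|) μ := by
    refine ⟨by fun_prop, ?_⟩
    rw [hasFiniteIntegral_iff_ofReal (Eventually.of_forall fun x => abs_nonneg x)]
    exact hK.trans_lt ENNReal.ofReal_lt_top
  have hiK : ∫ x, |x| ∂μ ≤ |K| := by
    rw [integral_eq_lintegral_of_nonneg_ae (Eventually.of_forall fun x => abs_nonneg x)
      (by fun_prop)]
    refine ENNReal.toReal_le_of_le_ofReal (abs_nonneg K) (hK.trans ?_)
    exact ENNReal.ofReal_le_ofReal (le_abs_self K)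
  have hv : Integrable (fun x : ℝ => (B - 1 / R * |θ|) + 1 / R * |x|) μ :=
    (integrable_const _).add (hi.const_mul _)
  have h1 := (le_integral_of_le_omega hv (fun x => (hψ (x - θ)).trans ?_) hc).1
  · rw [integral_add (integrable_const _) (hi.const_mul _), integral_const, probReal_univ,
      integral_const_mul] at h1
    simp only [smul_eq_mul, one_mul] at h1
    have h2 : 1 / R * ∫ x, |x| ∂μ ≤ 1 / R * |K| := by gcongr
    have h3 : 1 / R * |θ| ≤ (B - c) + 1 / R * |K| := by linarith
    have h4 := mul_le_mul_of_nonneg_left h3 hR.le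
    field_simp at h4
    linarith
  · rw [EReal.coe_le_coe_iff]
    have h2 : |θ| ≤ |x - θ| + |x| := by
      have := abs_sub_le θ x 0
      rw [sub_zero, sub_zero, abs_sub_comm θ x] at this
      exact this
    have h3 : 1 / R * |θ| ≤ 1 / R * (|x - θ| + |x|) := by gcongr
    linarith

/-- Upper semicontinuity of the criterion. -/
lemma le_Psi_of_eventually_le {μ : Measure ℝ} [IsProbabilityMeasure μ] {μs : ℕ → Measure ℝ}
    (h : Approx μs μ) {θs : ℕ → ℝ} {ψs : ℕ → ℝ → EReal} {θ : ℝ} {ψ : ℝ → EReal} {B : ℝ}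
    (hB0 : 0 ≤ B) (hSC : ∀ n, SC 0 (ψs n)) (hB : ∀ n, ψs n 0 ≤ B)
    (hψ : SC 0 ψ) (hψB : ψ 0 ≤ B) (hθ : Tendsto θs atTop (𝓝 θ)) (hlim : HypoTendsto ψs ψ)
    {c : ℝ} (hc : ∀ᶠ n in atTop, (c : EReal) ≤ Psi (θs n) (ψs n) (μs n)) :
    (c : EReal) ≤ Psi θ ψ μ := by
  have hcB : c ≤ B := by
    obtain ⟨n, h1, h4⟩ := (h.prob.and hc).exists
    simpa using (le_integral_of_le_omega (v := fun _ => B) (integrable_const B)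
      (fun x => ((hSC n).apply_le_zero (x - θs n)).trans (hB n)) h4).1
  refine (le_omega_iff hB0 (hψ.1.comp_sub θ).measurable
    (fun x => (hψ.apply_le_zero _).trans hψB) hcB).2 ?_
  rw [lintegral_exp_comp_sub]
  -- The measure, the function and the shift vary together. The upper bound along moving points in
  -- `HypoTendsto`, applied at `x - θs n`, is exactly what the varying Fatou lemma requires.
  have hA : ∫⁻ x, ((B : EReal) - ψ (x - θ)).toENNReal ∂μ ≤
      liminf (fun n => ∫⁻ x, ((B : EReal) - ψs n (x - θs n)).toENNReal ∂(μs n)) atTop := by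
    refine lintegral_le_liminf_lintegral_varying h.open_le fun x t ht => ?_
    lift t to NNReal using (ht.trans_le le_top).ne
    have key : ∀ y : EReal, (t : ℝ≥0∞) < ((B : EReal) - y).toENNReal ↔ y < ((B - t : ℝ) : EReal) := by
      intro y
      induction y with
      | bot => simpa [sub_eq_add_neg] using EReal.bot_lt_coe (B - t)
      | top => simp [sub_eq_add_neg]
      | coe y =>
        rw [← EReal.coe_sub, EReal.real_coe_toENNReal, EReal.coe_lt_coe_iff,
          ENNReal.lt_ofReal_iff_toReal_lt (by simp), ENNReal.coe_toReal]
        constructor <;> intro h <;> linarith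
    simp only [key] at ht ⊢
    have h1 := hlim.1 _ _ ht
    have h2 : Tendsto (fun p : ℕ × ℝ => (p.1, p.2 - θs p.1)) (atTop ×ˢ 𝓝 x)
        (atTop ×ˢ 𝓝 (x - θ)) :=
      tendsto_fst.prodMk (tendsto_snd.sub (hθ.comp tendsto_fst))
    exact h2.eventually h1
  have hE := lintegral_exp_le_liminf hlim (fun n => (hSC n).1.measurable) hψ.1
  refine (add_le_add hA hE).trans (add_liminf_le ?_)
  filter_upwards [h.prob, hc] with n h1 h4
  rw [← lintegral_exp_comp_sub (ψs n) (θs n)]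
  exact (le_omega_iff hB0 ((hSC n).1.comp_sub _).measurable
    (fun x => ((hSC n).apply_le_zero _).trans (hB n)) hcB).1 h4

/-- Compactness of almost maximizers. -/
theorem exists_subseq_limit {μ : Measure ℝ} [IsProbabilityMeasure μ] (hμ : ∀ a, μ {a}ᶜ ≠ 0)
    {μs : ℕ → Measure ℝ} (h : Approx μs μ) {θs : ℕ → ℝ} {ψs : ℕ → ℝ → EReal} {c : ℝ}
    (hSC : ∀ᶠ n in atTop, SC 0 (ψs n))
    (hc : ∀ᶠ n in atTop, (c : EReal) ≤ Psi (θs n) (ψs n) (μs n)) :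
    ∃ (σ : ℕ → ℕ) (θ : ℝ) (ψ : ℝ → EReal), StrictMono σ ∧
      Tendsto (fun n => θs (σ n)) atTop (𝓝 θ) ∧ SC 0 ψ ∧ HypoTendsto (fun n => ψs (σ n)) ψ ∧
      ∀ c' : ℝ, (∀ᶠ n in atTop, (c' : EReal) ≤ Psi (θs (σ n)) (ψs (σ n)) (μs (σ n))) →
        (c' : EReal) ≤ Psi θ ψ μ := by
  -- The bounds depend on one another in this order: mass outside short intervals gives `B`; then `∫
  -- e^ψ ≤ B - c` gives a drop of `1` at `R`; the tent `B + 1 - |x| / R` and the moment bound `K`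
  -- then confine `θ`.
  obtain ⟨r, hr, δ, hδ, hout⟩ := exists_mass_outside hμ
  obtain ⟨B, hB0, hB⟩ := exists_apply_zero_le c hr hδ
  obtain ⟨R, hR, hdrop⟩ := SC.exists_drop c (B - c)
  obtain ⟨K, hK⟩ := h.moment
  obtain ⟨N, hN⟩ := eventually_atTop.1
    (h.prob.and ((hout μs h.open_le).and (hK.and (hSC.and hc))))
  have hN' : ∀ n, ψs (n + N) 0 ≤ B := fun n => by
    obtain ⟨h1, h2, h3, h4, h5⟩ := hN (n + N) (Nat.le_add_left _ _)
    exact hB _ _ _ (h2 _) h4 h5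
  have hcN : ∀ n, (c : EReal) ≤ ψs (n + N) 0 := fun n => by
    obtain ⟨h1, h2, h3, h4, h5⟩ := hN (n + N) (Nat.le_add_left _ _)
    obtain ⟨M, hM⟩ := h4.exists_apply_zero
    rw [hM, EReal.coe_le_coe_iff]
    simpa using (le_integral_of_le_omega (v := fun _ => M) (integrable_const M)
      (fun x => hM ▸ h4.apply_le_zero (x - θs (n + N))) h5).1
  have hSCN : ∀ n, SC 0 (ψs (n + N)) := fun n => (hN (n + N) (Nat.le_add_left _ _)).2.2.2.1
  have hθN : ∀ n, θs (n + N) ∈ Set.Icc (-(R * (B + 1 - c) + |K|)) (R * (B + 1 - c) + |K|) := by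
    intro n
    obtain ⟨h1, h2, h3, h4, h5⟩ := hN (n + N) (Nat.le_add_left _ _)
    refine abs_le.1 (abs_le_of_le_Psi hR h3 (fun x => ?_) h5)
    obtain ⟨M, hM⟩ := h4.exists_apply_zero
    have hMc : c ≤ M := by have := hcN n; rwa [hM, EReal.coe_le_coe_iff] at this
    have hMB : M ≤ B := by have := hN' n; rwa [hM, EReal.coe_le_coe_iff] at this
    have hI : ∫⁻ x, (ψs (n + N) x).exp ≤ ENNReal.ofReal (B - c) := by
      rw [← lintegral_exp_comp_sub _ (θs (n + N))]
      simpa using (le_integral_of_le_omega (v := fun _ => B) (integrable_const B)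
        (fun x => (h4.apply_le_zero (x - θs (n + N))).trans (hN' n)) h5).2
    have hd : ψs (n + N) R ≤ ((M - 1 : ℝ) : EReal) :=
      (hdrop _ h4 hI).trans (EReal.coe_le_coe_iff.2 (by linarith))
    refine (h4.le_tent hM hR zero_le_one hd x).trans (EReal.coe_le_coe_iff.2 (by linarith))
  obtain ⟨σ₁, ψ, hσ₁, hψ, hψB, hlim⟩ := exists_subseq_hypoTendsto hSCN hcN hN'
  obtain ⟨θ, -, σ₂, hσ₂, hθ⟩ := isCompact_Icc.tendsto_subseq fun n => hθN (σ₁ n)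
  have hσ : StrictMono fun n => σ₁ (σ₂ n) + N := (hσ₁.comp hσ₂).add_const N
  have hlim' := hlim.comp_tendsto hσ₂.tendsto_atTop
  refine ⟨fun n => σ₁ (σ₂ n) + N, θ, ψ, hσ, hθ, hψ, hlim', fun c' hc' => ?_⟩
  exact le_Psi_of_eventually_le (h.comp_tendsto hσ.tendsto_atTop) hB0.le
    (fun n => hSCN _) (fun n => hN' _) hψ hψB hθ hlim' hc'

/-! ### Existence of maximizers -/

lemma Psi_le_L {μ : Measure ℝ} {θ : ℝ} {ψ : ℝ → EReal} (hψ : SC 0 ψ) : Psi θ ψ μ ≤ L μ :=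
  le_iSup_of_le θ (le_iSup₂_of_le ψ hψ le_rfl)

lemma isMaximizer_iff {μ : Measure ℝ} {θ : ℝ} {ψ : ℝ → EReal} :
    IsMaximizer μ θ ψ ↔ SC 0 ψ ∧ Psi θ ψ μ = L μ := by
  constructor
  · rintro ⟨h1, h2⟩
    exact ⟨h1, (Psi_le_L h1).antisymm (iSup_le fun θ' => iSup₂_le fun ψ' h' => h2 θ' ψ' h')⟩
  · rintro ⟨h1, h2⟩
    exact ⟨h1, fun θ' ψ' h' => h2 ▸ Psi_le_L h'⟩

/-- A test function whose criterion is finite under every probability measure with a first moment;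
it keeps `L` away from `⊥`. -/
lemma sc_neg_abs : SC 0 fun x => ((-|x| : ℝ) : EReal) := by
  refine ⟨⟨?_, fun x => EReal.coe_lt_top _, ⟨0, EReal.coe_ne_bot _⟩, ?_⟩, fun x => by simp⟩
  · intro p hp q hq a b ha hb hab
    simp only [Set.mem_ofPred_eq, EReal.coe_le_coe_iff, Prod.fst_add, Prod.smul_fst, smul_eq_mul,
      Prod.snd_add, Prod.smul_snd] at hp hq ⊢
    have h1 := abs_add_le (a * p.1) (b * q.1)
    rw [abs_mul, abs_mul, abs_of_nonneg ha, abs_of_nonneg hb] at h1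
    nlinarith
  · exact (continuous_coe_real_ereal.comp (by fun_prop)).upperSemicontinuous

lemma integrable_exp_neg_mul_abs {a : ℝ} (ha : 0 < a) :
    Integrable fun x : ℝ => Real.exp (-(a * |x|)) := by
  rw [← integrableOn_univ, ← Set.Iic_union_Ioi (a := (0 : ℝ)), integrableOn_union]
  refine ⟨(integrableOn_exp_mul_Iic ha 0).congr_fun (fun x hx => ?_) measurableSet_Iic,
    (exp_neg_integrableOn_Ioi 0 ha).congr_fun (fun x hx => ?_) measurableSet_Ioi⟩
  · simp only [abs_of_nonpos (Set.mem_Iic.1 hx), mul_neg, neg_neg]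
  · simp only [abs_of_pos (Set.mem_Ioi.1 hx), neg_mul]

lemma L_ne_bot {μ : Measure ℝ} [IsProbabilityMeasure μ]
    (h : ∫⁻ x, ENNReal.ofReal |x| ∂μ ≠ ⊤) : L μ ≠ ⊥ := by
  refine ne_bot_of_le_ne_bot ?_ (Psi_le_L (θ := 0) sc_neg_abs)
  have hi : Integrable (fun x : ℝ => |x|) μ := by
    refine ⟨by fun_prop, ?_⟩
    rw [hasFiniteIntegral_iff_ofReal (Eventually.of_forall fun x => abs_nonneg x)]
    exact h.lt_top
  have hg : OmegaFinite (fun x => ((-|x| : ℝ) : EReal)) μ := by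
    refine ⟨by simp, by simpa using hi.neg, ?_⟩
    simpa only [EReal.exp_coe, one_mul] using
      (integrable_exp_neg_mul_abs one_pos).lintegral_lt_top.ne
  have := hg.omega_eq fun x => EReal.coe_lt_top _
  simp only [Psi, sub_zero, this]
  exact EReal.coe_ne_bot _

/-- The direct method: a maximizing sequence is handled by the compactness theorem with the constant
sequence of measures. -/
theorem exists_isMaximizer {μ : Measure ℝ} [IsProbabilityMeasure μ] (hμ : ∀ a, μ {a}ᶜ ≠ 0)
    (h : ∫⁻ x, ENNReal.ofReal |x| ∂μ ≠ ⊤) : ∃ θ ψ, IsMaximizer μ θ ψ := by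
  set S : Set EReal := {y | ∃ θ ψ, SC 0 ψ ∧ Psi θ ψ μ = y} with hS
  have hL : sSup S = L μ := by
    refine le_antisymm (sSup_le ?_) (iSup_le fun θ => iSup₂_le fun ψ hψ => ?_)
    · rintro _ ⟨θ, ψ, hψ, rfl⟩
      exact Psi_le_L hψ
    · exact le_sSup ⟨θ, ψ, hψ, rfl⟩
  obtain ⟨y, -, hy, hyS⟩ := exists_seq_tendsto_sSup (S := S) ⟨_, 0, _, sc_neg_abs, rfl⟩
    (OrderTop.bddAbove S)
  choose θs ψs hψs hy' using hyS
  rw [hL] at hy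
  have hev : ∀ c : EReal, c < L μ → ∀ᶠ n in atTop, c ≤ Psi (θs n) (ψs n) μ := fun c hc =>
    (hy.eventually (lt_mem_nhds hc)).mono fun n hn => by rw [hy']; exact hn.le
  obtain ⟨c, -, hc⟩ := EReal.lt_iff_exists_real_btwn.1 (bot_lt_iff_ne_bot.2 (L_ne_bot h))
  obtain ⟨σ, θ, ψ, hσ, -, hψ, -, hlim⟩ := exists_subseq_limit hμ (approx_const h)
    (Eventually.of_forall hψs) (hev c hc)
  refine ⟨θ, ψ, isMaximizer_iff.2 ⟨hψ, (Psi_le_L hψ).antisymm ?_⟩⟩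
  exact EReal.ge_of_forall_gt_iff_ge.1 fun t ht =>
    hlim t (hσ.tendsto_atTop.eventually (hev t ht))

/-! ### Midpoints, strict concavity and uniqueness -/

open Classical in
/-- The midpoint of two functions with values in `[-∞, ∞)`. -/
noncomputable def midpointFun (φ χ : ℝ → EReal) (x : ℝ) : EReal :=
  if φ x = ⊥ ∨ χ x = ⊥ then ⊥ else (((φ x).toReal + (χ x).toReal) / 2 : ℝ)

section midpoint
variable {φ χ : ℝ → EReal}

lemma midpointFun_coe {x a b : ℝ} (ha : φ x = a) (hb : χ x = b) :
    midpointFun φ χ x = ((a + b) / 2 : ℝ) := by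
  simp [midpointFun, ha, hb]

lemma midpointFun_bot {x : ℝ} (h : φ x = ⊥ ∨ χ x = ⊥) : midpointFun φ χ x = ⊥ := by
  simp only [midpointFun, if_pos h]

lemma midpointFun_ne_bot {x : ℝ} (h : φ x ≠ ⊥) (h' : χ x ≠ ⊥) : midpointFun φ χ x ≠ ⊥ := by
  rw [midpointFun, if_neg (by tauto)]
  exact EReal.coe_ne_bot _

lemma le_midpointFun {x a b : ℝ} (hφ : φ x < ⊤) (hχ : χ x < ⊤) (ha : (a : EReal) ≤ φ x)
    (hb : (b : EReal) ≤ χ x) : (((a + b) / 2 : ℝ) : EReal) ≤ midpointFun φ χ x := by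
  have h1 := EReal.coe_toReal hφ.ne (ne_of_gt ((EReal.bot_lt_coe a).trans_le ha))
  have h2 := EReal.coe_toReal hχ.ne (ne_of_gt ((EReal.bot_lt_coe b).trans_le hb))
  rw [midpointFun_coe h1.symm h2.symm]
  rw [← h1, EReal.coe_le_coe_iff] at ha
  rw [← h2, EReal.coe_le_coe_iff] at hb
  rw [EReal.coe_le_coe_iff]
  linarith

lemma exists_of_le_midpointFun {x t : ℝ} (hφ : φ x < ⊤) (hχ : χ x < ⊤)
    (h : (t : EReal) ≤ midpointFun φ χ x) :
    ∃ a b : ℝ, (a : EReal) ≤ φ x ∧ (b : EReal) ≤ χ x ∧ t = (a + b) / 2 := by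
  have hne : ¬ (φ x = ⊥ ∨ χ x = ⊥) := fun h' => by
    rw [midpointFun_bot h'] at h
    exact absurd h (by simp)
  push Not at hne
  have h1 := EReal.coe_toReal hφ.ne hne.1
  have h2 := EReal.coe_toReal hχ.ne hne.2
  rw [midpointFun_coe h1.symm h2.symm, EReal.coe_le_coe_iff] at h
  refine ⟨(φ x).toReal, 2 * t - (φ x).toReal, h1.le, ?_, by ring⟩
  rw [← h2, EReal.coe_le_coe_iff]
  linarith

lemma midpointFun_lt_of_lt {x a b : ℝ} (hφ : φ x < a) (hχ : χ x < b) :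
    midpointFun φ χ x < ((a + b) / 2 : ℝ) := by
  by_cases hne : φ x = ⊥ ∨ χ x = ⊥
  · rw [midpointFun_bot hne]
    exact EReal.bot_lt_coe _
  push Not at hne
  have h1 := EReal.coe_toReal (hφ.trans (EReal.coe_lt_top a)).ne hne.1
  have h2 := EReal.coe_toReal (hχ.trans (EReal.coe_lt_top b)).ne hne.2
  rw [midpointFun_coe h1.symm h2.symm, EReal.coe_lt_coe_iff]
  rw [← h1, EReal.coe_lt_coe_iff] at hφ
  rw [← h2, EReal.coe_lt_coe_iff] at hχ
  linarith

lemma exists_of_midpointFun_lt {x t : ℝ} (hφ : φ x < ⊤) (hχ : χ x < ⊤)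
    (h : midpointFun φ χ x < t) :
    ∃ a b : ℝ, φ x < a ∧ χ x < b ∧ (a + b) / 2 ≤ t := by
  by_cases h1 : φ x = ⊥
  · obtain ⟨b, hb, -⟩ := EReal.lt_iff_exists_real_btwn.1 hχ
    exact ⟨2 * t - b, b, h1 ▸ EReal.bot_lt_coe _, hb, by linarith⟩
  by_cases h2 : χ x = ⊥
  · obtain ⟨a, ha, -⟩ := EReal.lt_iff_exists_real_btwn.1 hφ
    exact ⟨a, 2 * t - a, ha, h2 ▸ EReal.bot_lt_coe _, by linarith⟩
  have h1 := EReal.coe_toReal hφ.ne h1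
  have h2 := EReal.coe_toReal hχ.ne h2
  rw [midpointFun_coe h1.symm h2.symm, EReal.coe_lt_coe_iff] at h
  obtain ⟨ε, hε⟩ : ∃ ε, ε = t - ((φ x).toReal + (χ x).toReal) / 2 := ⟨_, rfl⟩
  refine ⟨(φ x).toReal + ε, (χ x).toReal + ε, ?_, ?_, by rw [hε]; linarith⟩
  · nth_rw 1 [← h1]; rw [EReal.coe_lt_coe_iff]; linarith
  · nth_rw 1 [← h2]; rw [EReal.coe_lt_coe_iff]; linarith

lemma ClosedProperConcave.midpointFun (hφ : ClosedProperConcave φ) (hχ : ClosedProperConcave χ)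
    (h : ∃ x, φ x ≠ ⊥ ∧ χ x ≠ ⊥) : ClosedProperConcave (midpointFun φ χ) where
  convex_hypograph := by
    intro p hp q hq a b ha hb hab
    obtain rfl : a = 1 - b := by linarith
    obtain ⟨u, v, hu, hv, huv⟩ := exists_of_le_midpointFun (hφ.lt_top _) (hχ.lt_top _) hp
    obtain ⟨u', v', hu', hv', huv'⟩ := exists_of_le_midpointFun (hφ.lt_top _) (hχ.lt_top _) hq
    have := le_midpointFun (hφ.lt_top _) (hχ.lt_top _) (hφ.le_apply hu hu' hb (by linarith))
      (hχ.le_apply hv hv' hb (by linarith))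
    simp only [Set.mem_ofPred_eq, Prod.fst_add, Prod.smul_fst, smul_eq_mul, Prod.snd_add,
      Prod.smul_snd]
    convert! this using 2
    rw [huv, huv']
    ring
  lt_top x := by
    unfold SymmLoc.midpointFun
    split_ifs
    · exact bot_lt_top
    · exact EReal.coe_lt_top _
  exists_ne_bot := h.imp fun x hx => midpointFun_ne_bot hx.1 hx.2
  upperSemicontinuous := by
    intro x t ht
    obtain ⟨t', ht', ht''⟩ := EReal.lt_iff_exists_real_btwn.1 ht
    obtain ⟨a, b, ha, hb, hab⟩ := exists_of_midpointFun_lt (hφ.lt_top x) (hχ.lt_top x) ht'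
    filter_upwards [hφ.upperSemicontinuous x a ha, hχ.upperSemicontinuous x b hb] with y hy1 hy2
    exact (midpointFun_lt_of_lt hy1 hy2).trans ((EReal.coe_le_coe_iff.2 hab).trans_lt ht'')

/-- The left side is the geometric mean of `e^φ` and `e^χ`, so this is AM-GM. -/
lemma expFun_midpointFun_le (hφ : ClosedProperConcave φ) (hχ : ClosedProperConcave χ) (x : ℝ) :
    expFun (midpointFun φ χ) x ≤ (expFun φ x + expFun χ x) / 2 := by
  by_cases h1 : φ x = ⊥ ∨ χ x = ⊥
  · rw [expFun_bot (midpointFun_bot h1)]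
    linarith [expFun_nonneg φ x, expFun_nonneg χ x]
  push Not at h1
  obtain ⟨a, ha⟩ := hφ.exists_coe h1.1
  obtain ⟨b, hb⟩ := hχ.exists_coe h1.2
  rw [expFun_coe (midpointFun_coe ha hb), expFun_coe ha, expFun_coe hb]
  have e1 : Real.exp ((a + b) / 2) = Real.exp (a / 2) * Real.exp (b / 2) := by
    rw [← Real.exp_add]; ring_nf
  have e2 : Real.exp a = Real.exp (a / 2) ^ 2 := by rw [sq, ← Real.exp_add]; ring_nf
  have e3 : Real.exp b = Real.exp (b / 2) ^ 2 := by rw [sq, ← Real.exp_add]; ring_nf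
  rw [e1, e2, e3]
  nlinarith [sq_nonneg (Real.exp (a / 2) - Real.exp (b / 2))]

/-- Equality case of AM-GM. Where one function is `-∞` the geometric mean vanishes, so both
exponentials do. -/
lemma eq_of_expFun_midpointFun_eq (hφ : ClosedProperConcave φ) (hχ : ClosedProperConcave χ) {x : ℝ}
    (h : expFun (midpointFun φ χ) x = (expFun φ x + expFun χ x) / 2) : φ x = χ x := by
  by_cases h1 : φ x = ⊥ ∨ χ x = ⊥
  · rw [expFun_bot (midpointFun_bot h1)] at h
    have h2 := expFun_nonneg φ x
    have h3 := expFun_nonneg χ x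
    have h4 : φ x = ⊥ := by
      by_contra hne
      have := (expFun_pos_iff (hφ.lt_top x)).2 hne
      linarith
    have h5 : χ x = ⊥ := by
      by_contra hne
      have := (expFun_pos_iff (hχ.lt_top x)).2 hne
      linarith
    rw [h4, h5]
  push Not at h1
  obtain ⟨a, ha⟩ := hφ.exists_coe h1.1
  obtain ⟨b, hb⟩ := hχ.exists_coe h1.2
  rw [expFun_coe (midpointFun_coe ha hb), expFun_coe ha, expFun_coe hb] at h
  have e1 : Real.exp ((a + b) / 2) = Real.exp (a / 2) * Real.exp (b / 2) := by
    rw [← Real.exp_add]; ring_nf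
  have e2 : Real.exp a = Real.exp (a / 2) ^ 2 := by rw [sq, ← Real.exp_add]; ring_nf
  have e3 : Real.exp b = Real.exp (b / 2) ^ 2 := by rw [sq, ← Real.exp_add]; ring_nf
  rw [e1, e2, e3] at h
  have h2 : (Real.exp (a / 2) - Real.exp (b / 2)) ^ 2 = 0 := by linarith
  have h3 := Real.exp_injective (sub_eq_zero.1 (pow_eq_zero_iff two_ne_zero |>.1 h2))
  rw [ha, hb]
  congr 1
  linarith

end midpoint

lemma OmegaFinite.integrable_expFun {φ : ℝ → EReal} {μ : Measure ℝ} (h : OmegaFinite φ μ)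
    (hm : Measurable φ) : Integrable (expFun φ) :=
  integrable_toReal_of_lintegral_ne_top hm.ereal_exp.aemeasurable h.lintegral_exp_ne_top

lemma OmegaFinite.omega_eq_integral {φ : ℝ → EReal} {μ : Measure ℝ} (h : OmegaFinite φ μ)
    (hφ : ClosedProperConcave φ) :
    omega φ μ = ((∫ x, (φ x).toReal ∂μ - ∫ x, expFun φ x : ℝ) : EReal) := by
  rw [h.omega_eq hφ.lt_top]
  congr 2
  exact (integral_toReal hφ.measurable.ereal_exp.aemeasurable
    (Eventually.of_forall fun x => EReal.exp_lt_top_iff.2 (hφ.lt_top x))).symm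

section
variable {φ χ : ℝ → EReal} {μ : Measure ℝ}

lemma OmegaFinite.exists_ne_bot [NeZero μ] (h1 : OmegaFinite φ μ) (h2 : OmegaFinite χ μ) :
    ∃ x, φ x ≠ ⊥ ∧ χ x ≠ ⊥ := (h1.ae_ne_bot.and h2.ae_ne_bot).exists

lemma toReal_midpointFun_ae (hφ : ClosedProperConcave φ) (hχ : ClosedProperConcave χ)
    (h1 : OmegaFinite φ μ) (h2 : OmegaFinite χ μ) :
    (fun x => (midpointFun φ χ x).toReal) =ᵐ[μ] fun x => ((φ x).toReal + (χ x).toReal) / 2 := by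
  filter_upwards [h1.ae_ne_bot, h2.ae_ne_bot] with x hx1 hx2
  obtain ⟨a, ha⟩ := hφ.exists_coe hx1
  obtain ⟨b, hb⟩ := hχ.exists_coe hx2
  rw [midpointFun_coe ha hb, ha, hb]
  simp

lemma OmegaFinite.midpointFun [NeZero μ] (hφ : ClosedProperConcave φ)
    (hχ : ClosedProperConcave χ) (h1 : OmegaFinite φ μ) (h2 : OmegaFinite χ μ) :
    OmegaFinite (midpointFun φ χ) μ where
  ae_ne_bot := by
    filter_upwards [h1.ae_ne_bot, h2.ae_ne_bot] with x hx1 hx2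
    exact midpointFun_ne_bot hx1 hx2
  integrable := ((h1.integrable.add h2.integrable).div_const 2).congr
    (toReal_midpointFun_ae hφ hχ h1 h2).symm
  lintegral_exp_ne_top := by
    have hm := hφ.midpointFun hχ (h1.exists_ne_bot h2)
    have hi := ((h1.integrable_expFun hφ.measurable).add
      (h2.integrable_expFun hχ.measurable)).div_const 2
    refine ((lintegral_mono fun x => ?_).trans_lt hi.lintegral_lt_top).ne
    rw [← ofReal_expFun (hm.lt_top x)]
    exact ENNReal.ofReal_le_ofReal (expFun_midpointFun_le hφ hχ x)

/-- Midpoint concavity of the criterion. -/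
lemma omega_midpointFun_ge [NeZero μ] (hφ : ClosedProperConcave φ)
    (hχ : ClosedProperConcave χ) (h1 : OmegaFinite φ μ) (h2 : OmegaFinite χ μ) {w : ℝ}
    (hw1 : (w : EReal) ≤ omega φ μ) (hw2 : (w : EReal) ≤ omega χ μ) :
    (w : EReal) ≤ omega (midpointFun φ χ) μ ∧
      (omega (midpointFun φ χ) μ ≤ w → φ =ᵐ[volume] χ) := by
  have hm := hφ.midpointFun hχ (h1.exists_ne_bot h2)
  have hmf := OmegaFinite.midpointFun hφ hχ h1 h2
  rw [h1.omega_eq_integral hφ, EReal.coe_le_coe_iff] at hw1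
  rw [h2.omega_eq_integral hχ, EReal.coe_le_coe_iff] at hw2
  rw [hmf.omega_eq_integral hm, EReal.coe_le_coe_iff, EReal.coe_le_coe_iff]
  have hi1 := h1.integrable_expFun hφ.measurable
  have hi2 := h2.integrable_expFun hχ.measurable
  have hi := (hi1.add hi2).div_const 2
  have him := hmf.integrable_expFun hm.measurable
  have e1 : ∫ x, (midpointFun φ χ x).toReal ∂μ
      = (∫ x, (φ x).toReal ∂μ + ∫ x, (χ x).toReal ∂μ) / 2 := by
    rw [integral_congr_ae (toReal_midpointFun_ae hφ hχ h1 h2), integral_div,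
      integral_add h1.integrable h2.integrable]
  have e2 : ∫ x, (expFun φ x + expFun χ x) / 2 = ((∫ x, expFun φ x) + ∫ x, expFun χ x) / 2 := by
    rw [integral_div, integral_add hi1 hi2]
  have hle : ∫ x, expFun (midpointFun φ χ) x ≤ ∫ x, (expFun φ x + expFun χ x) / 2 :=
    integral_mono him hi fun x => expFun_midpointFun_le hφ hχ x
  rw [e1]
  refine ⟨by linarith, fun hge => ?_⟩
  -- The linear term is exactly averaged, so without a gain the AM-GM defect, which is nonnegative,
  -- has zero integral.
  have hz : ∫ x, ((expFun φ x + expFun χ x) / 2 - expFun (midpointFun φ χ) x) = 0 := by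
    have : ∫ x, ((expFun φ x + expFun χ x) / 2 - expFun (midpointFun φ χ) x)
      = (∫ x, (expFun φ x + expFun χ x) / 2) - ∫ x, expFun (midpointFun φ χ) x := integral_sub hi him
    rw [this]
    linarith
  rw [integral_eq_zero_iff_of_nonneg (fun x => sub_nonneg.2 (expFun_midpointFun_le hφ hχ x))
    (hi.sub him)] at hz
  filter_upwards [hz] with x hx
  exact eq_of_expFun_midpointFun_eq hφ hχ (sub_eq_zero.1 hx).symm

end

/-- If `χ x < t < φ x`, then close to `x` on the segment towards `z` concavity keeps `φ > t` and
upper semicontinuity keeps `χ < t`. Such an interval contains a point where the two functions agree,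
as these points are dense. -/
lemma ClosedProperConcave.le_of_ae_eq {φ χ : ℝ → EReal} (hφ : ClosedProperConcave φ)
    (hχ : ClosedProperConcave χ) (h : φ =ᵐ[volume] χ) {x z : ℝ} (hz : φ z ≠ ⊥) (hxz : z ≠ x) :
    φ x ≤ χ x := by
  refine EReal.ge_of_forall_gt_iff_ge.1 fun t ht => ?_
  by_contra! hlt
  obtain ⟨a, hta, ha⟩ := EReal.lt_iff_exists_real_btwn.1 ht
  obtain ⟨b, hb⟩ := exists_coe_le hz
  rw [EReal.coe_lt_coe_iff] at hta
  have hlim : ∀ᶠ s in 𝓝 (0 : ℝ), t < (1 - s) * a + s * b := by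
    have : Tendsto (fun s : ℝ => (1 - s) * a + s * b) (𝓝 0) (𝓝 ((1 - 0) * a + 0 * b)) :=
      Continuous.tendsto (by fun_prop) 0
    rw [sub_zero, one_mul, zero_mul, add_zero] at this
    exact this.eventually (lt_mem_nhds hta)
  have hus : ∀ᶠ s in 𝓝 (0 : ℝ), χ ((1 - s) * x + s * z) < t := by
    have : Tendsto (fun s : ℝ => (1 - s) * x + s * z) (𝓝 0) (𝓝 ((1 - 0) * x + 0 * z)) :=
      Continuous.tendsto (by fun_prop) 0
    rw [sub_zero, one_mul, zero_mul, add_zero] at this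
    exact this.eventually (hχ.upperSemicontinuous x t hlt)
  obtain ⟨ε, hε, hball⟩ := Metric.eventually_nhds_iff.1 (hlim.and hus)
  have hopen : IsOpen ((fun y => (y - x) / (z - x)) ⁻¹' Set.Ioo 0 (min ε 1)) :=
    isOpen_Ioo.preimage (by fun_prop)
  have hzx : z - x ≠ 0 := sub_ne_zero.2 hxz
  have hmin : 0 < min ε 1 := lt_min hε one_pos
  obtain ⟨y, hy, hyeq⟩ := (Measure.dense_of_ae h).exists_mem_open hopen
    ⟨x + min ε 1 / 2 * (z - x), by
      simp only [Set.mem_preimage, add_sub_cancel_left, mul_div_cancel_right₀ _ hzx]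
      constructor <;> linarith⟩
  obtain ⟨s, hs⟩ : ∃ s, s = (y - x) / (z - x) := ⟨_, rfl⟩
  simp only [Set.mem_preimage, ← hs] at hyeq
  have hsy : (1 - s) * x + s * z = y := by
    rw [hs]; field_simp; ring
  have hs1 : s < ε := hyeq.2.trans_le (min_le_left _ _)
  obtain ⟨h1, h2⟩ := hball (y := s) (by
    rw [Real.dist_eq, sub_zero, abs_of_pos hyeq.1]; exact hs1)
  have h3 := hφ.le_apply ha.le hb hyeq.1.le (hyeq.2.le.trans (min_le_right _ _))
  rw [hsy] at h2 h3
  have hy' : φ y = χ y := hy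
  rw [hy'] at h3
  exact absurd (h3.trans_lt h2) (not_lt.2 (EReal.coe_le_coe_iff.2 h1.le))

/-- Absolute continuity excludes atoms, so for each `x` there is a common domain point `z ≠ x` from
which to approach `x`. -/
lemma ClosedProperConcave.eq_of_ae_eq {φ χ : ℝ → EReal} (hφ : ClosedProperConcave φ)
    (hχ : ClosedProperConcave χ) (h : φ =ᵐ[volume] χ) {μ : Measure ℝ} [NeZero μ]
    (hμ : μ ≪ volume) (hφμ : ∀ᵐ x ∂μ, φ x ≠ ⊥) : φ = χ := by
  funext x
  have hx : ∀ᵐ y ∂μ, y ≠ x := by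
    have : volume ({x} : Set ℝ) = 0 := by simp
    exact compl_mem_ae_iff.2 (hμ this)
  obtain ⟨z, hz, hzx, hz'⟩ := (hφμ.and (hx.and (hμ.ae_le h))).exists
  exact (hφ.le_of_ae_eq hχ h hz hzx).antisymm (hχ.le_of_ae_eq hφ h.symm (hz' ▸ hz) hzx)

/-- Any two maximizers of the criterion over closed proper concave functions agree. -/
lemma eq_of_omega_eq {μ : Measure ℝ} [NeZero μ] (hμ : μ ≪ volume) {φ χ : ℝ → EReal} {w : ℝ}
    (hφ : ClosedProperConcave φ) (hχ : ClosedProperConcave χ) (h1 : OmegaFinite φ μ)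
    (h2 : OmegaFinite χ μ) (hw : ∀ ξ, ClosedProperConcave ξ → omega ξ μ ≤ w)
    (hw1 : omega φ μ = w) (hw2 : omega χ μ = w) : φ = χ := by
  have h := omega_midpointFun_ge hφ hχ h1 h2 hw1.ge hw2.ge
  exact hφ.eq_of_ae_eq hχ (h.2 (hw _ (hφ.midpointFun hχ (h1.exists_ne_bot h2)))) hμ h1.ae_ne_bot

/-! ### Log-concave projection of a symmetric distribution -/

section symmetric
variable {μ : Measure ℝ}

lemma lintegral_comp_neg (hμ : μ.map (fun x => -x) = μ) {f : ℝ → ℝ≥0∞} (hf : Measurable f) :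
    ∫⁻ x, f (-x) ∂μ = ∫⁻ x, f x ∂μ := by
  conv_rhs => rw [← hμ]
  rw [lintegral_map hf measurable_neg]

lemma ae_comp_neg (hμ : μ.map (fun x => -x) = μ) {p : ℝ → Prop} (h : ∀ᵐ x ∂μ, p x) :
    ∀ᵐ x ∂μ, p (-x) := by
  rw [← hμ] at h
  exact ae_of_ae_map measurable_neg.aemeasurable h

lemma omega_comp_neg (hμ : μ.map (fun x => -x) = μ) {φ : ℝ → EReal} (hφ : Measurable φ) :
    omega (fun x => φ (-x)) μ = omega φ μ := by
  unfold omega eintegral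
  rw [lintegral_comp_neg hμ (f := fun x => (φ x).toENNReal) (by fun_prop),
    lintegral_comp_neg hμ (f := fun x => (-φ x).toENNReal) (by fun_prop),
    lintegral_neg_eq_self (fun x => (φ x).exp)]

/-- Concavity gives `χ(x) + χ(-x) ≤ 2 χ(0)`, hence `χ(x)⁺ ≤ (2 χ(0))⁺ + χ(-x)⁻`; under a symmetric
measure the negative part therefore controls the positive part. -/
lemma finite_of_symmetric [IsProbabilityMeasure μ] (hμ : μ.map (fun x => -x) = μ)
    {χ : ℝ → EReal} (hχ : ClosedProperConcave χ) (h : omega χ μ ≠ ⊥) : OmegaFinite χ μ := by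
  refine finite_of_omega_ne_bot hχ.measurable hχ.lt_top ?_ h
  obtain ⟨h1, -⟩ := lintegral_ne_top_of_omega_ne_bot h
  have hb := ae_ne_bot_of_lintegral_neg hχ.measurable h1
  have hb' := ae_comp_neg hμ hb
  have hmid : ∀ {x a b : ℝ}, χ x = a → χ (-x) = b → (((a + b) / 2 : ℝ) : EReal) ≤ χ 0 := by
    intro x a b ha hb
    have := hχ.le_apply ha.ge hb.ge (s := 1 / 2) (by norm_num) (by norm_num)
    convert! this using 2 <;> ring
  obtain ⟨x, hx, hx'⟩ := (hb.and hb').exists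
  obtain ⟨a, ha⟩ := hχ.exists_coe hx
  obtain ⟨b, hb0⟩ := hχ.exists_coe hx'
  obtain ⟨B, hB⟩ := hχ.exists_coe (x := 0)
    (ne_of_gt ((EReal.bot_lt_coe _).trans_le (hmid ha hb0)))
  have hm : Measurable fun x => (-χ x).toENNReal := by
    have := hχ.measurable
    fun_prop
  have hle : ∫⁻ x, (χ x).toENNReal ∂μ ≤ ∫⁻ x, (ENNReal.ofReal (2 * B) + (-χ (-x)).toENNReal) ∂μ := by
    refine lintegral_mono_ae ?_
    filter_upwards [hb, hb'] with x hx hx'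
    obtain ⟨a, ha⟩ := hχ.exists_coe hx
    obtain ⟨b, hb⟩ := hχ.exists_coe hx'
    have := hmid ha hb
    rw [hB, EReal.coe_le_coe_iff] at this
    rw [ha, hb, ← EReal.coe_neg, EReal.real_coe_toENNReal, EReal.real_coe_toENNReal]
    exact (ENNReal.ofReal_le_ofReal (by linarith)).trans ENNReal.ofReal_add_le
  refine (hle.trans_lt ?_).ne
  rw [lintegral_add_left (by fun_prop), lintegral_comp_neg hμ hm]
  refine ENNReal.add_lt_top.2 ⟨?_, h1.lt_top⟩
  rw [lintegral_const, measure_univ, mul_one]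
  exact ENNReal.ofReal_lt_top

/-- Symmetrization does not decrease the criterion of a symmetric distribution. -/
lemma exists_symmetrization [IsProbabilityMeasure μ] (hμ : μ.map (fun x => -x) = μ)
    {χ : ℝ → EReal} (hχ : ClosedProperConcave χ) (h : omega χ μ ≠ ⊥) :
    ∃ ψ, SC 0 ψ ∧ OmegaFinite ψ μ ∧ omega χ μ ≤ omega ψ μ := by
  have h1 := finite_of_symmetric hμ hχ h
  have heq := omega_comp_neg hμ hχ.measurable
  have h2 : OmegaFinite (fun x => χ (-x)) μ :=
    finite_of_symmetric hμ hχ.comp_neg (by rwa [heq])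
  refine ⟨midpointFun χ fun x => χ (-x), ⟨hχ.midpointFun hχ.comp_neg (h1.exists_ne_bot h2), ?_⟩,
    OmegaFinite.midpointFun hχ hχ.comp_neg h1 h2, ?_⟩
  · intro x
    simp only [midpointFun, zero_add, zero_sub, neg_neg, or_comm (a := χ x = ⊥),
      add_comm (χ x).toReal]
  · have hw := h1.omega_eq_integral hχ
    rw [hw]
    exact (omega_midpointFun_ge hχ hχ.comp_neg h1 h2 hw.ge (heq.trans hw).ge).1

lemma compl_singleton_ne_zero [IsProbabilityMeasure μ] (h : μ ≪ volume) (a : ℝ) :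
    μ {a}ᶜ ≠ 0 := by
  intro ha
  rw [prob_compl_eq_zero_iff (measurableSet_singleton a), h (by simp)] at ha
  exact zero_ne_one ha

/-- The log-concave projection of a symmetric distribution exists, is unique, and is symmetric. -/
theorem exists_projection [IsProbabilityMeasure μ] (hμ : μ.map (fun x => -x) = μ)
    (hac : μ ≪ volume) (hmom : ∫⁻ x, ENNReal.ofReal |x| ∂μ ≠ ⊤) :
    ∃ ψ, SC 0 ψ ∧ OmegaFinite ψ μ ∧ (∀ χ, ClosedProperConcave χ → omega χ μ ≤ omega ψ μ) ∧
      ∀ χ, ClosedProperConcave χ → omega χ μ = omega ψ μ → χ = ψ := by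
  obtain ⟨θ₁, ψ₁, hmax⟩ := exists_isMaximizer (compl_singleton_ne_zero hac) hmom
  rw [isMaximizer_iff] at hmax
  have hω : omega (fun x => ψ₁ (x - θ₁)) μ = L μ := hmax.2
  -- A translate of the maximizer of `Ψ` lies in the class `𝒞`; symmetrizing it about `0` loses
  -- nothing. Any competitor `χ` is symmetrized as well and compared through `L μ`.
  obtain ⟨ψ, hψ, hfin, hle⟩ := exists_symmetrization hμ (hmax.1.1.comp_sub θ₁)
    (by rw [hω]; exact L_ne_bot hmom)
  rw [hω] at hle
  have hSC : ∀ ξ, SC 0 ξ → omega ξ μ ≤ L μ := fun ξ hξ => by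
    have := Psi_le_L (μ := μ) (θ := 0) hξ
    simpa [Psi] using this
  have hall : ∀ χ, ClosedProperConcave χ → omega χ μ ≤ omega ψ μ := by
    intro χ hχ
    by_cases hb : omega χ μ = ⊥
    · rw [hb]; exact bot_le
    · obtain ⟨ξ, hξ, -, h⟩ := exists_symmetrization hμ hχ hb
      exact h.trans ((hSC ξ hξ).trans hle)
  refine ⟨ψ, hψ, hfin, hall, fun χ hχ heq => ?_⟩
  have hw := hfin.omega_eq_integral hψ.1
  have hχf : OmegaFinite χ μ := finite_of_symmetric hμ hχ (by
    rw [heq, hw]; exact EReal.coe_ne_bot _)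
  exact eq_of_omega_eq hac hχ hψ.1 hχf hfin (fun ξ hξ => (hall ξ hξ).trans hw.le)
    (heq.trans hw) hw

end symmetric

/-! ### Normalization of the maximizer -/

lemma OmegaFinite.omega_add_const {φ : ℝ → EReal} {μ : Measure ℝ} [IsProbabilityMeasure μ]
    (h : OmegaFinite φ μ) (hφ : ClosedProperConcave φ) (c : ℝ) :
    omega (fun x => φ x + c) μ = ((∫ x, (φ x).toReal ∂μ + c -
      (∫⁻ x, (φ x).exp).toReal * Real.exp c : ℝ) : EReal) := by
  have hae : (fun x => (φ x + c).toReal) =ᵐ[μ] fun x => (φ x).toReal + c := by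
    filter_upwards [h.ae_ne_bot] with x hx
    obtain ⟨a, ha⟩ := hφ.exists_coe hx
    rw [ha, ← EReal.coe_add, EReal.toReal_coe, EReal.toReal_coe]
  have hexp : ∫⁻ x, (φ x + c).exp = (∫⁻ x, (φ x).exp) * ENNReal.ofReal (Real.exp c) := by
    simp only [EReal.exp_add, EReal.exp_coe]
    exact lintegral_mul_const _ hφ.measurable.ereal_exp
  have hf : OmegaFinite (fun x => φ x + c) μ := by
    refine ⟨h.ae_ne_bot.mono fun x hx => by simp [EReal.add_eq_bot_iff, hx],
      (h.integrable.add (integrable_const c)).congr hae.symm, ?_⟩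
    rw [hexp]
    exact ENNReal.mul_ne_top h.lintegral_exp_ne_top ENNReal.ofReal_ne_top
  rw [hf.omega_eq (hφ.add_const c).lt_top, hexp, ENNReal.toReal_mul,
    ENNReal.toReal_ofReal (Real.exp_pos c).le, integral_congr_ae hae,
    integral_add h.integrable (integrable_const c)]
  simp

/-- A maximizer of the criterion is a log-density. -/
lemma lintegral_exp_eq_one {φ : ℝ → EReal} {μ : Measure ℝ} [IsProbabilityMeasure μ]
    (h : OmegaFinite φ μ) (hφ : ClosedProperConcave φ)
    (hmax : ∀ χ, ClosedProperConcave χ → omega χ μ ≤ omega φ μ) : ∫⁻ x, (φ x).exp = 1 := by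
  obtain ⟨I, hI⟩ : ∃ I, I = (∫⁻ x, (φ x).exp).toReal := ⟨_, rfl⟩
  have hc : ∀ c : ℝ, c - I * Real.exp c ≤ -I := by
    intro c
    have := hmax _ (hφ.add_const c)
    rw [h.omega_add_const hφ, h.omega_eq hφ.lt_top, EReal.coe_le_coe_iff, ← hI] at this
    linarith
  have hI0 : 0 ≤ I := hI ▸ ENNReal.toReal_nonneg
  have hIpos : 0 < I := by
    rcases hI0.eq_or_lt with h0 | h0
    · have := hc 1
      rw [← h0] at this
      linarith
    · exact h0
  -- The shift that normalizes the total mass to `1` gives `I - 1 ≤ log I`, which forces `I = 1`.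
  have h1 := hc (-Real.log I)
  rw [Real.exp_neg, Real.exp_log hIpos, mul_inv_cancel₀ hIpos.ne'] at h1
  have hI1 : I = 1 := by
    by_contra hne
    have := Real.log_lt_sub_one_of_pos hIpos hne
    linarith
  rw [← ENNReal.ofReal_toReal h.lintegral_exp_ne_top, ← hI, hI1, ENNReal.ofReal_one]

lemma isDensity_expFun {φ : ℝ → EReal} (hφ : ClosedProperConcave φ)
    (h : ∫⁻ x, (φ x).exp = 1) : IsDensity (expFun φ) where
  measurable := measurable_expFun hφ.measurable
  nonneg := expFun_nonneg φ
  lintegral_eq_one := by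
    rw [← h]
    exact lintegral_congr fun x => ofReal_expFun (hφ.lt_top x)

/-! ### Laws with a density and their translates -/

section law
variable {f : ℝ → ℝ}

lemma isProbabilityMeasure_law (h : IsDensity f) : IsProbabilityMeasure (law f) :=
  ⟨by rw [law, withDensity_apply _ MeasurableSet.univ, Measure.restrict_univ, h.lintegral_eq_one]⟩

lemma law_absolutelyContinuous (f : ℝ → ℝ) : law f ≪ volume :=
  withDensity_absolutelyContinuous _ _

lemma lintegral_law (h : IsDensity f) {g : ℝ → ℝ≥0∞} (hg : Measurable g) :
    ∫⁻ x, g x ∂(law f) = ∫⁻ x, ENNReal.ofReal (f x) * g x :=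
  lintegral_withDensity_eq_lintegral_mul _ h.measurable.ennreal_ofReal hg

lemma IsDensity.comp_add (h : IsDensity f) (t : ℝ) : IsDensity fun x => f (x + t) where
  measurable := h.measurable.comp (measurable_id.add_const t)
  nonneg x := h.nonneg _
  lintegral_eq_one := by
    rw [lintegral_add_right_eq_self (fun x => ENNReal.ofReal (f x)) t]
    exact h.lintegral_eq_one

lemma map_neg_law (h : IsDensity f) (hs : SymmAbout 0 f) :
    (law f).map (fun x => -x) = law f := by
  refine Measure.ext_of_lintegral _ fun g hg => ?_
  rw [lintegral_map hg measurable_neg, lintegral_law h (g := fun x => g (-x)) (by fun_prop),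
    lintegral_law h hg, ← lintegral_neg_eq_self fun x => ENNReal.ofReal (f x) * g x]
  simp only [hs.neg]

lemma map_add_law (h : IsDensity f) (t : ℝ) :
    (law fun x => f (x + t)).map (fun x => x + t) = law f := by
  refine Measure.ext_of_lintegral _ fun g hg => ?_
  rw [lintegral_map hg (by fun_prop), lintegral_law (h.comp_add t) (g := fun x => g (x + t))
    (by fun_prop), lintegral_law h hg,
    lintegral_add_right_eq_self (fun x => ENNReal.ofReal (f x) * g x) t]

lemma omega_law (h : IsDensity f) (t : ℝ) {φ : ℝ → EReal} (hφ : Measurable φ) :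
    omega φ (law f) = omega (fun x => φ (x + t)) (law fun x => f (x + t)) := by
  conv_lhs => rw [← map_add_law h t]
  unfold omega eintegral
  rw [lintegral_map (by fun_prop) (by fun_prop), lintegral_map (by fun_prop) (by fun_prop),
    lintegral_add_right_eq_self (fun x => (φ x).exp) t]

lemma Psi_law (h : IsDensity f) (t θ : ℝ) {ψ : ℝ → EReal} (hψ : Measurable ψ) :
    Psi θ ψ (law f) = omega (fun x => ψ (x - (θ - t))) (law fun x => f (x + t)) := by
  rw [Psi, omega_law h t (by fun_prop)]
  congr 2 with x
  congr 1
  ring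

lemma lintegral_abs_law_ne_top (h : IsDensity f) (hm : ∫⁻ x, ENNReal.ofReal (|x| * f x) < ⊤) :
    ∫⁻ x, ENNReal.ofReal |x| ∂(law f) ≠ ⊤ := by
  rw [lintegral_law h (by fun_prop)]
  refine (lt_of_le_of_lt (lintegral_mono fun x => ?_) hm).ne
  rw [← ENNReal.ofReal_mul (h.nonneg x), mul_comm]

lemma lintegral_abs_law_comp_add_ne_top (h : IsDensity f) (t : ℝ)
    (hm : ∫⁻ x, ENNReal.ofReal |x| ∂(law f) ≠ ⊤) :
    ∫⁻ x, ENNReal.ofReal |x| ∂(law fun x => f (x + t)) ≠ ⊤ := by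
  have := isProbabilityMeasure_law (h.comp_add t)
  rw [← map_add_law h t, lintegral_map (by fun_prop) (by fun_prop)] at hm
  have hle : ∀ x : ℝ, ENNReal.ofReal |x| ≤ ENNReal.ofReal |x + t| + ENNReal.ofReal |t| := by
    intro x
    rw [← ENNReal.ofReal_add (abs_nonneg _) (abs_nonneg _)]
    refine ENNReal.ofReal_le_ofReal ?_
    have := abs_sub (x + t) t
    rwa [add_sub_cancel_right] at this
  refine ((lintegral_mono hle).trans_lt ?_).ne
  rw [lintegral_add_right _ (by fun_prop), lintegral_const, measure_univ, mul_one]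
  exact ENNReal.add_lt_top.2 ⟨hm.lt_top, ENNReal.ofReal_lt_top⟩

end law

lemma SC.exists_tent {ψ : ℝ → EReal} (h : SC 0 ψ) (hI : ∫⁻ x, (ψ x).exp ≠ ⊤) :
    ∃ B a : ℝ, 0 < a ∧ ∀ x, ψ x ≤ ((B - a * |x| : ℝ) : EReal) := by
  obtain ⟨M, hM⟩ := h.exists_apply_zero
  obtain ⟨R, hR, hdrop⟩ := SC.exists_drop M (∫⁻ x, (ψ x).exp).toReal
  exact ⟨M + 1, 1 / R, by positivity,
    h.le_tent hM hR zero_le_one (hdrop ψ h (ENNReal.ofReal_toReal hI).ge)⟩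

/-! ### The log-concave model and Gibbs' inequality -/

section wellSpecified
variable {g : ℝ → ℝ}

lemma SLC.sc_logFun (h : SLC 0 g) : SC 0 (logFun g) :=
  ⟨h.2.1, fun x => by simp only [logFun, h.2.2 x]⟩

lemma exp_logFun (g : ℝ → ℝ) (x : ℝ) : (logFun g x).exp = ENNReal.ofReal (g x) := by
  rw [logFun, ENNReal.exp_log]

lemma expFun_logFun {x : ℝ} (h : 0 ≤ g x) : expFun (logFun g) x = g x := by
  rw [expFun, exp_logFun, ENNReal.toReal_ofReal h]

lemma logFun_of_pos {x : ℝ} (h : 0 < g x) : logFun g x = Real.log (g x) := by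
  rw [logFun, ENNReal.log_ofReal_of_pos h]

lemma SLC.lintegral_exp (h : SLC 0 g) : ∫⁻ x, (logFun g x).exp = 1 := by
  simp only [exp_logFun]
  exact h.1.lintegral_eq_one

lemma SLC.exists_le (h : SLC 0 g) : ∃ B a : ℝ, 0 < a ∧ ∀ x, g x ≤ Real.exp (B - a * |x|) := by
  obtain ⟨B, a, ha, hle⟩ := h.sc_logFun.exists_tent (by rw [h.lintegral_exp]; simp)
  refine ⟨B, a, ha, fun x => ?_⟩
  rw [← expFun_logFun (h.1.nonneg x)]
  exact expFun_le (hle x)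

/-- The log-concave model is contained in the model of bounded densities with a first moment. -/
lemma MemP0.memP1 {f : ℝ → ℝ} (h : MemP0 f) : MemP1 f := by
  obtain ⟨hf, ⟨θ, g, hg, hfg⟩, -⟩ := h
  obtain ⟨B, a, ha, hle⟩ := hg.exists_le
  refine ⟨hf, ⟨θ, fun x => ?_⟩, ⟨Real.exp B, fun x => ?_⟩, ?_⟩
  · have := hg.2.2 x
    rw [hfg, hfg]
    convert! this using 2 <;> ring
  · rw [hfg]
    refine (hle _).trans (Real.exp_le_exp.2 ?_)
    have : 0 ≤ a * |x - θ| := by positivity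
    linarith
  · rw [← lintegral_add_right_eq_self (fun x => ENNReal.ofReal (|x| * f x)) θ]
    have hi : Integrable fun x : ℝ =>
        (Real.exp B * (2 / a + |θ|)) * Real.exp (-(a / 2 * |x|)) :=
      (integrable_exp_neg_mul_abs (half_pos ha)).const_mul _
    refine lt_of_le_of_lt (lintegral_mono fun x => ENNReal.ofReal_le_ofReal ?_) hi.lintegral_lt_top
    rw [hfg, add_sub_cancel_right]
    have h1 : |x + θ| ≤ |x| + |θ| := abs_add_le _ _
    -- Half of the exponential decay of `g` is spent on absorbing the factor `|x + θ|`.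
    have h2 : |x| ≤ 2 / a * Real.exp (a / 2 * |x|) := by
      have := Real.add_one_le_exp (a / 2 * |x|)
      have h3 : |x| = 2 / a * (a / 2 * |x|) := by field_simp
      have h4 : 2 / a * (a / 2 * |x|) ≤ 2 / a * Real.exp (a / 2 * |x|) := by
        gcongr; linarith
      linarith
    have h3 : |θ| ≤ |θ| * Real.exp (a / 2 * |x|) :=
      le_mul_of_one_le_right (abs_nonneg _) (Real.one_le_exp (by positivity))
    have h4 : Real.exp (B - a * |x|) = Real.exp B * Real.exp (-(a / 2 * |x|)) *
        Real.exp (-(a / 2 * |x|)) := by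
      rw [← Real.exp_add, ← Real.exp_add]; ring_nf
    have h5 : Real.exp (a / 2 * |x|) * Real.exp (-(a / 2 * |x|)) = 1 := by
      rw [← Real.exp_add]; simp
    calc |x + θ| * g x ≤ ((2 / a + |θ|) * Real.exp (a / 2 * |x|)) * Real.exp (B - a * |x|) := by
          gcongr
          · exact hg.1.nonneg x
          · linarith
          · exact hle x
      _ = Real.exp B * (2 / a + |θ|) * Real.exp (-(a / 2 * |x|)) *
          (Real.exp (a / 2 * |x|) * Real.exp (-(a / 2 * |x|))) := by rw [h4]; ring
      _ = _ := by rw [h5, mul_one]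

/-- Half of the exponential absorbs `|y|`: the product `|y| e^(y/2)` is at most `2` for `y ≤ 0` and
at most `|B| e^|B|` for `0 ≤ y ≤ B`. With `y = log g` this makes `g log g` integrable. -/
lemma abs_mul_exp_le {y T B : ℝ} (h : y ≤ T) (hT : T ≤ B) :
    |y| * Real.exp y ≤ (2 + |B| * Real.exp |B|) * Real.exp (T / 2) := by
  have h1 : Real.exp y = Real.exp (y / 2) * Real.exp (y / 2) := by
    rw [← Real.exp_add]; ring_nf
  have h2 : Real.exp (y / 2) ≤ Real.exp (T / 2) := Real.exp_le_exp.2 (by linarith)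
  have h3 : |y| * Real.exp (y / 2) ≤ 2 + |B| * Real.exp |B| := by
    have hB : 0 ≤ |B| * Real.exp |B| := by positivity
    rcases le_total y 0 with hy | hy
    · have h4 := Real.add_one_le_exp (-y / 2)
      have h5 : Real.exp (-y / 2) * Real.exp (y / 2) = 1 := by
        rw [← Real.exp_add]; ring_nf; simp
      have h6 : |y| ≤ 2 * Real.exp (-y / 2) := by rw [abs_of_nonpos hy]; linarith
      have h7 : |y| * Real.exp (y / 2) ≤ 2 * Real.exp (-y / 2) * Real.exp (y / 2) := by gcongr
      rw [mul_assoc, h5] at h7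
      linarith
    · have h4 : |y| ≤ |B| := abs_le_abs_of_nonneg hy (h.trans hT)
      have h5 : Real.exp (y / 2) ≤ Real.exp |B| :=
        Real.exp_le_exp.2 (by linarith [le_abs_self y])
      have : |y| * Real.exp (y / 2) ≤ |B| * Real.exp |B| := by gcongr
      linarith
  rw [h1, ← mul_assoc]
  gcongr

lemma SLC.omegaFinite (h : SLC 0 g) : OmegaFinite (logFun g) (law g) := by
  obtain ⟨B, a, ha, hle⟩ := h.exists_le
  have hm := h.2.1.measurable
  have hgm := h.1.measurable
  refine ⟨?_, ⟨hm.ereal_toReal.aestronglyMeasurable, ?_⟩, by rw [h.lintegral_exp]; simp⟩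
  · rw [law, ae_withDensity_iff hgm.ennreal_ofReal]
    refine Eventually.of_forall fun x hx hx' => hx ?_
    rw [← exp_logFun, hx', EReal.exp_bot]
  · have hi : Integrable fun x : ℝ =>
        ((2 + |B| * Real.exp |B|) * Real.exp (B / 2)) * Real.exp (-(a / 2 * |x|)) :=
      (integrable_exp_neg_mul_abs (half_pos ha)).const_mul _
    rw [HasFiniteIntegral, lintegral_law h.1 (by fun_prop)]
    refine lt_of_le_of_lt (lintegral_mono fun x => ?_) hi.lintegral_lt_top
    rw [Real.enorm_eq_ofReal_abs, ← ENNReal.ofReal_mul (h.1.nonneg x)]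
    refine ENNReal.ofReal_le_ofReal ?_
    rcases (h.1.nonneg x).eq_or_lt with h0 | h0
    · rw [← h0, zero_mul]; positivity
    · have hlog : Real.log (g x) ≤ B - a * |x| := (Real.log_le_iff_le_exp h0).2 (hle x)
      have h0' : 0 ≤ a * |x| := by positivity
      have h1 := abs_mul_exp_le hlog (show B - a * |x| ≤ B by linarith)
      rw [Real.exp_log h0] at h1
      rw [logFun_of_pos h0, EReal.toReal_coe, mul_comm]
      refine h1.trans (le_of_eq ?_)
      rw [mul_assoc, ← Real.exp_add]
      ring_nf

lemma integral_law (h : IsDensity g) (u : ℝ → ℝ) : ∫ x, u x ∂(law g) = ∫ x, g x * u x := by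
  rw [law, integral_withDensity_eq_integral_toReal_smul h.measurable.ennreal_ofReal
    (Eventually.of_forall fun x => ENNReal.ofReal_lt_top)]
  simp only [ENNReal.toReal_ofReal (h.nonneg _), smul_eq_mul]

lemma integrable_law_iff (h : IsDensity g) (u : ℝ → ℝ) :
    Integrable u (law g) ↔ Integrable fun x => g x * u x := by
  rw [law, integrable_withDensity_iff_integrable_smul' h.measurable.ennreal_ofReal
    (Eventually.of_forall fun x => ENNReal.ofReal_lt_top)]
  simp only [ENNReal.toReal_ofReal (h.nonneg _), smul_eq_mul]

/-- Gibbs' inequality: the log-density of a log-concave density maximizes its own criterion. -/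
lemma SLC.omega_le (h : SLC 0 g) {χ : ℝ → EReal} (hχ : ClosedProperConcave χ) :
    omega χ (law g) ≤ omega (logFun g) (law g) := by
  have := isProbabilityMeasure_law h.1
  by_cases hb : omega χ (law g) = ⊥
  · rw [hb]; exact bot_le
  have h1 := finite_of_symmetric (map_neg_law h.1 h.2.2) hχ hb
  have h2 := h.omegaFinite
  rw [h1.omega_eq_integral hχ, h2.omega_eq_integral h.2.1, EReal.coe_le_coe_iff,
    integral_law h.1, integral_law h.1]
  have i1 := (integrable_law_iff h.1 _).1 h1.integrable
  have i2 := (integrable_law_iff h.1 _).1 h2.integrable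
  have i3 := h1.integrable_expFun hχ.measurable
  have i4 := h2.integrable_expFun h.2.1.measurable
  -- Pointwise, `u ↦ g u - e^u` is largest at `u = log g`; where `g = 0` it is at most `0`.
  have key : ∫ x, (g x * (χ x).toReal - expFun χ x) ≤
      ∫ x, (g x * (logFun g x).toReal - expFun (logFun g) x) := by
    refine integral_mono_ae (i1.sub i3) (i2.sub i4) ?_
    have hae := h1.ae_ne_bot
    rw [law, ae_withDensity_iff h.1.measurable.ennreal_ofReal] at hae
    filter_upwards [hae] with x hx
    simp only [expFun_logFun (h.1.nonneg x)]
    rcases (h.1.nonneg x).eq_or_lt with h0 | h0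
    · rw [← h0]
      linarith [expFun_nonneg χ x]
    · obtain ⟨u, hu⟩ := hχ.exists_coe (hx (by simpa using h0))
      rw [expFun_coe hu, hu, logFun_of_pos h0, EReal.toReal_coe, EReal.toReal_coe]
      have h3 := Real.add_one_le_exp (u - Real.log (g x))
      have h4 : Real.exp u = g x * Real.exp (u - Real.log (g x)) := by
        rw [Real.exp_sub, Real.exp_log h0]; field_simp
      have h5 : g x * (u - Real.log (g x) + 1) ≤ g x * Real.exp (u - Real.log (g x)) := by gcongr
      rw [h4]
      linarith
  rw [integral_sub i1 i3, integral_sub i2 i4] at key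
  exact key

/-- The centre named by the model and the given centre `θ₀` agree, because a log-concave density has
only one centre of symmetry. -/
lemma MemP0.slc {f : ℝ → ℝ} (h : MemP0 f) {θ₀ : ℝ} (hs : SymmAbout θ₀ f) :
    SLC 0 fun x => f (x + θ₀) := by
  obtain ⟨-, ⟨θ, g, hg, hfg⟩, -⟩ := h
  have hτ : SymmAbout (θ₀ - θ) (logFun g) := by
    intro x
    have := hs x
    rw [hfg, hfg] at this
    have e1 : θ₀ - θ + x = θ₀ + x - θ := by ring
    have e2 : θ₀ - θ - x = θ₀ - x - θ := by ring
    simp only [logFun, e1, e2, this]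
  have h0 := hg.sc_logFun.eq_zero_of_symmAbout (by rw [hg.lintegral_exp]; simp) hτ
  have : (fun x => f (x + θ₀)) = g := by
    funext x
    rw [hfg, add_sub_assoc, h0, add_zero]
  rwa [this]

lemma MemP0.continuous {f : ℝ → ℝ} (h : MemP0 f) : Continuous f := by
  rw [continuous_iff_continuousAt]
  intro x
  have := (h.2.2.1 (x - 1) (x + 1)).continuousOn
  rw [Set.uIcc_of_le (by linarith)] at this
  exact this.continuousAt (Icc_mem_nhds (by linarith) (by linarith))

end wellSpecified

/-! ### Empirical measures -/

section empirical

lemma lintegral_empirical (x : ℕ → ℝ) (n : ℕ) (g : ℝ → ℝ≥0∞) :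
    ∫⁻ y, g y ∂(empirical x n) = (n : ℝ≥0∞)⁻¹ * ∑ i ∈ Finset.range n, g (x i) := by
  rw [empirical, lintegral_smul_measure, lintegral_finsetSum_measure]
  simp

lemma empirical_apply (x : ℕ → ℝ) (n : ℕ) {s : Set ℝ} (hs : MeasurableSet s) :
    empirical x n s = (n : ℝ≥0∞)⁻¹ * ∑ i ∈ Finset.range n, s.indicator 1 (x i) := by
  simp [empirical, hs]

lemma isProbabilityMeasure_empirical (x : ℕ → ℝ) {n : ℕ} (hn : n ≠ 0) :
    IsProbabilityMeasure (empirical x n) := by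
  refine ⟨?_⟩
  rw [empirical_apply x n MeasurableSet.univ]
  simp only [Set.indicator_univ, Pi.one_apply, Finset.sum_const, Finset.card_range, nsmul_eq_mul,
    mul_one]
  exact ENNReal.inv_mul_cancel (by simpa using hn) (by simp)

lemma ofReal_sum_div (x : ℕ → ℝ) {n : ℕ} (hn : n ≠ 0) {g : ℝ → ℝ} (hg : ∀ y, 0 ≤ g y) :
    ENNReal.ofReal ((∑ i ∈ Finset.range n, g (x i)) / n)
      = ∫⁻ y, ENNReal.ofReal (g y) ∂(empirical x n) := by
  rw [lintegral_empirical, ENNReal.ofReal_div_of_pos (by positivity),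
    ENNReal.ofReal_sum_of_nonneg fun i _ => hg _, ENNReal.ofReal_natCast, ENNReal.div_eq_inv_mul]

lemma ae_empirical {x : ℕ → ℝ} {p : ℝ → Prop} (h : ∀ i, p (x i)) (n : ℕ) :
    ∀ᵐ y ∂(empirical x n), p y := by
  refine Measure.ae_smul_measure ?_ _
  rw [ae_finsetSum_measure_iff]
  intro i _
  rw [ae_dirac_eq]
  exact h i

lemma lintegral_ofReal_empirical_ne_top (x : ℕ → ℝ) {n : ℕ} (hn : n ≠ 0) (g : ℝ → ℝ) :
    ∫⁻ y, ENNReal.ofReal (g y) ∂(empirical x n) ≠ ⊤ := by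
  rw [lintegral_empirical]
  exact ENNReal.mul_ne_top (by simpa using hn) (by simp)

lemma integrable_empirical (x : ℕ → ℝ) {n : ℕ} (hn : n ≠ 0) {g : ℝ → ℝ} (hg : Measurable g) :
    Integrable g (empirical x n) := by
  refine ⟨hg.aestronglyMeasurable, ?_⟩
  rw [hasFiniteIntegral_iff_norm]
  exact (lintegral_ofReal_empirical_ne_top x hn _).lt_top

lemma integral_empirical (x : ℕ → ℝ) (n : ℕ) (g : ℝ → ℝ) :
    ∫ y, g y ∂(empirical x n) = (∑ i ∈ Finset.range n, g (x i)) / n := by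
  rw [empirical, integral_smul_measure, integral_finsetSum_measure fun i _ => integrable_dirac (by simp)]
  simp [div_eq_inv_mul]

/-- A maximum likelihood estimate exists as soon as the observations do not all coincide. -/
lemma exists_isMLE {x : ℕ → ℝ} {n : ℕ} (hn : 2 ≤ n) (h : x 0 ≠ x 1) : ∃ θ ψ, IsMLE x n θ ψ := by
  have hn0 : n ≠ 0 := by omega
  have := isProbabilityMeasure_empirical x hn0
  refine exists_isMaximizer (fun a ha => ?_) (lintegral_ofReal_empirical_ne_top x hn0 _)
  rw [empirical_apply x n (measurableSet_singleton a).compl, mul_eq_zero] at ha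
  rcases ha with ha | ha
  · simp at ha
  · rw [Finset.sum_eq_zero_iff] at ha
    have h0 := ha 0 (Finset.mem_range.2 (by omega))
    have h1 := ha 1 (Finset.mem_range.2 (by omega))
    simp only [Set.indicator_apply_eq_zero, Set.mem_compl_iff, Set.mem_singleton_iff,
      Pi.one_apply, one_ne_zero, imp_false, not_not] at h0 h1
    exact h (h0.trans h1.symm)

end empirical

/-! ### Strong laws for empirical measures and the criterion -/

section slln
variable {Ω : Type*} [MeasurableSpace Ω] {P : Measure Ω}
  {X : ℕ → Ω → ℝ} {μ : Measure ℝ}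

lemma ae_tendsto_average (hX : ∀ i, HasLaw (X i) μ P) (hi : iIndepFun X P) {g : ℝ → ℝ}
    (hg : Measurable g) (hgi : Integrable g μ) :
    ∀ᵐ ω ∂P, Tendsto (fun n : ℕ => (∑ i ∈ Finset.range n, g (X i ω)) / n) atTop
      (𝓝 (∫ y, g y ∂μ)) := by
  have h0 : Integrable (fun ω => g (X 0 ω)) P := by
    rw [← (hX 0).map_eq] at hgi
    exact hgi.comp_aemeasurable (hX 0).aemeasurable
  have hE : ∫ ω, g (X 0 ω) ∂P = ∫ y, g y ∂μ := by
    rw [← (hX 0).map_eq]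
    exact (integral_map (hX 0).aemeasurable hg.aestronglyMeasurable).symm
  have := strong_law_ae_real (fun i ω => g (X i ω)) h0
    (fun i j hij => (hi.indepFun hij).comp hg hg)
    (fun i => (IdentDistrib.mk (hX i).aemeasurable (hX 0).aemeasurable
      ((hX i).map_eq.trans (hX 0).map_eq.symm)).comp hg)
  rw [hE] at this
  exact this

lemma ae_tendsto_empirical_apply [IsProbabilityMeasure μ] (hX : ∀ i, HasLaw (X i) μ P)
    (hi : iIndepFun X P) {s : Set ℝ} (hs : MeasurableSet s) :
    ∀ᵐ ω ∂P, Tendsto (fun n => empirical (fun i => X i ω) n s) atTop (𝓝 (μ s)) := by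
  filter_upwards [ae_tendsto_average hX hi (measurable_one.indicator hs)
    ((integrable_const (1 : ℝ)).indicator hs)] with ω hω
  have h1 : ∫ y, s.indicator (1 : ℝ → ℝ) y ∂μ = μ.real s := integral_indicator_one hs
  rw [h1] at hω
  have h2 := ENNReal.tendsto_ofReal hω
  rw [ofReal_measureReal] at h2
  refine h2.congr' ?_
  filter_upwards [eventually_ne_atTop 0] with n hn
  rw [ofReal_sum_div (fun i => X i ω) hn fun y => Set.indicator_nonneg (by simp) y,
    ← lintegral_indicator_one hs]
  refine lintegral_congr fun y => ?_
  by_cases hy : y ∈ s <;> simp [hy]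

/-- Every open set is an increasing union of finite unions of basic sets. There are only countably
many such finite unions, so one null set serves all open sets. -/
lemma le_liminf_of_countable_family {μs : ℕ → Measure ℝ}
    (h : ∀ t : Finset (TopologicalSpace.countableBasis ℝ),
      Tendsto (fun n => μs n (⋃ u ∈ t, (u : Set ℝ))) atTop (𝓝 (μ (⋃ u ∈ t, (u : Set ℝ)))))
    {G : Set ℝ} (hG : IsOpen G) : μ G ≤ liminf (fun n => μs n G) atTop := by
  classical
  obtain ⟨S, hS, rfl⟩ := (TopologicalSpace.isBasis_countableBasis ℝ).open_eq_sUnion hG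
  rcases S.eq_empty_or_nonempty with rfl | hne
  · simp
  obtain ⟨f, rfl⟩ := ((TopologicalSpace.countable_countableBasis ℝ).mono hS).exists_eq_range hne
  have hf : ∀ i, f i ∈ TopologicalSpace.countableBasis ℝ := fun i => hS ⟨i, rfl⟩
  rw [Set.sUnion_range, measure_iUnion_eq_iSup_accumulate]
  refine iSup_le fun k => ?_
  have hacc : Set.accumulate f k = ⋃ u ∈ (Finset.range (k + 1)).image fun i =>
      (⟨f i, hf i⟩ : TopologicalSpace.countableBasis ℝ), (u : Set ℝ) := by
    ext y
    simp [Set.mem_accumulate]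
  rw [hacc, ← (h _).liminf_eq]
  refine liminf_le_liminf (Eventually.of_forall fun n => measure_mono ?_)
  rw [← hacc]
  exact Set.accumulate_subset_iUnion k

/-- Almost surely the empirical measures approximate the common distribution. -/
lemma ae_approx_empirical [IsProbabilityMeasure μ] (hX : ∀ i, HasLaw (X i) μ P)
    (hi : iIndepFun X P) (hmom : ∫⁻ x, ENNReal.ofReal |x| ∂μ ≠ ⊤) :
    ∀ᵐ ω ∂P, Approx (fun n => empirical (fun i => X i ω) n) μ := by
  have : Countable (TopologicalSpace.countableBasis ℝ) :=
    (TopologicalSpace.countable_countableBasis ℝ).to_subtype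
  have hmi : Integrable (fun x : ℝ => |x|) μ := by
    refine ⟨by fun_prop, ?_⟩
    rw [hasFiniteIntegral_iff_ofReal (Eventually.of_forall fun x => abs_nonneg x)]
    exact hmom.lt_top
  have h1 : ∀ᵐ ω ∂P, ∀ t : Finset (TopologicalSpace.countableBasis ℝ),
      Tendsto (fun n => empirical (fun i => X i ω) n (⋃ u ∈ t, (u : Set ℝ))) atTop
        (𝓝 (μ (⋃ u ∈ t, (u : Set ℝ)))) := by
    rw [ae_all_iff]
    intro t
    refine ae_tendsto_empirical_apply hX hi (IsOpen.measurableSet ?_)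
    exact isOpen_biUnion fun u _ => TopologicalSpace.isOpen_of_mem_countableBasis u.2
  filter_upwards [h1, ae_tendsto_average hX hi (by fun_prop) hmi] with ω hω1 hω2
  refine ⟨?_, fun G hG => le_liminf_of_countable_family hω1 hG, ∫ x, |x| ∂μ + 1, ?_⟩
  · filter_upwards [eventually_ne_atTop 0] with n hn
    exact isProbabilityMeasure_empirical _ hn
  · filter_upwards [eventually_ne_atTop 0, hω2.eventually (gt_mem_nhds (lt_add_one _))] with n hn h2
    rw [← ofReal_sum_div (fun i => X i ω) hn fun y => abs_nonneg y]
    exact ENNReal.ofReal_le_ofReal h2.le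

/-- The diagonal is null for `μ × μ`. Distinct first two observations secure existence of the
estimate for all `n ≥ 2` at once. -/
lemma ae_ne_of_nullSingleton [IsProbabilityMeasure P] [IsProbabilityMeasure μ] [NullSingletonClass μ] (hX : ∀ i, HasLaw (X i) μ P)
    (hi : iIndepFun X P) : ∀ᵐ ω ∂P, X 0 ω ≠ X 1 ω := by
  have h := (indepFun_iff_map_prod_eq_prod_map_map (hX 0).aemeasurable (hX 1).aemeasurable).1
    (hi.indepFun zero_ne_one)
  rw [(hX 0).map_eq, (hX 1).map_eq] at h
  have hd : (μ.prod μ) {p : ℝ × ℝ | p.1 = p.2} = 0 := by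
    rw [Measure.measure_prod_null (measurableSet_eq_fun measurable_fst measurable_snd)]
    refine Eventually.of_forall fun x => ?_
    have : Prod.mk x ⁻¹' {p : ℝ × ℝ | p.1 = p.2} = {x} := by
      ext y; simp [eq_comm]
    simp [this]
  have hae : ∀ᵐ p ∂(μ.prod μ), p.1 ≠ p.2 := by
    rw [ae_iff]; simpa using hd
  rw [← h] at hae
  exact ae_of_ae_map ((hX 0).aemeasurable.prodMk (hX 1).aemeasurable) hae

/-- The strong law for the criterion at a fixed argument. -/
lemma ae_tendsto_Psi_empirical (hX : ∀ i, HasLaw (X i) μ P) (hi : iIndepFun X P) {θ : ℝ}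
    {ψ : ℝ → EReal} (hψ : ClosedProperConcave ψ) (hf : OmegaFinite (fun x => ψ (x - θ)) μ) :
    ∀ᵐ ω ∂P, Tendsto (fun n => Psi θ ψ (empirical (fun i => X i ω) n)) atTop (𝓝 (Psi θ ψ μ)) := by
  have hφ := hψ.comp_sub θ
  have hm : Measurable fun x => (ψ (x - θ)).toReal := hφ.measurable.ereal_toReal
  have hbot : ∀ᵐ ω ∂P, ∀ i, ψ (X i ω - θ) ≠ ⊥ := by
    rw [ae_all_iff]
    intro i
    have := hf.ae_ne_bot
    rw [← (hX i).map_eq] at this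
    exact ae_of_ae_map (hX i).aemeasurable this
  filter_upwards [hbot, ae_tendsto_average hX hi hm hf.integrable] with ω hω1 hω2
  rw [Psi, hf.omega_eq hφ.lt_top]
  have h2 := (continuous_coe_real_ereal.tendsto _).comp
    (hω2.sub_const (∫⁻ x, (ψ (x - θ)).exp).toReal)
  refine h2.congr' ?_
  filter_upwards [eventually_ne_atTop 0] with n hn
  have hfn : OmegaFinite (fun x => ψ (x - θ)) (empirical (fun i => X i ω) n) :=
    ⟨ae_empirical hω1 n, integrable_empirical _ hn hm, hf.lintegral_exp_ne_top⟩
  rw [Psi, hfn.omega_eq hφ.lt_top, integral_empirical]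
  rfl

end slln

/-! ### Convergence of maximal values and maximizers -/

lemma eventually_of_subseq {p : ℕ → Prop}
    (h : ∀ σ : ℕ → ℕ, StrictMono σ → ∃ τ : ℕ → ℕ, ∃ᶠ n in atTop, p (σ (τ n))) :
    ∀ᶠ n in atTop, p n := by
  by_contra hne
  obtain ⟨σ, hσ, hσp⟩ := extraction_of_frequently_atTop (not_eventually.1 hne)
  obtain ⟨τ, hτ⟩ := h σ hσ
  obtain ⟨n, hn⟩ := hτ.exists
  exact hσp _ hn

section consistency
variable {μ : Measure ℝ} [IsProbabilityMeasure μ] {μs : ℕ → Measure ℝ}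

/-- Compactness gives the upper half: values staying above `c > L μ` along a subsequence would
produce a limit pair with criterion at least `c`. Upper semicontinuity gives no lower half, hence
`hlow`. -/
lemma tendsto_L (hμ : ∀ a, μ {a}ᶜ ≠ 0) (h : Approx μs μ)
    (hlow : ∀ c : ℝ, (c : EReal) < L μ → ∀ᶠ n in atTop, (c : EReal) < L (μs n)) :
    Tendsto (fun n => L (μs n)) atTop (𝓝 (L μ)) := by
  refine tendsto_order.2 ⟨fun t ht => ?_, fun t ht => ?_⟩
  · obtain ⟨c, htc, hc⟩ := EReal.lt_iff_exists_real_btwn.1 ht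
    exact (hlow c hc).mono fun n hn => htc.trans hn
  · obtain ⟨c, hc, hct⟩ := EReal.lt_iff_exists_real_btwn.1 ht
    by_contra hno
    obtain ⟨σ, hσ, hσt⟩ := extraction_of_frequently_atTop (not_eventually.1 hno)
    have hge : ∀ n, ∃ θ ψ, SC 0 ψ ∧ (c : EReal) < Psi θ ψ (μs (σ n)) := by
      intro n
      have hlt := hct.trans_le (not_lt.1 (hσt n))
      rw [L, lt_iSup_iff] at hlt
      obtain ⟨θ, hlt⟩ := hlt
      rw [lt_iSup_iff] at hlt
      obtain ⟨ψ, hlt⟩ := hlt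
      rw [lt_iSup_iff] at hlt
      obtain ⟨hψ, hlt⟩ := hlt
      exact ⟨θ, ψ, hψ, hlt⟩
    choose θs ψs hψs hgt using hge
    obtain ⟨τ, θ, ψ, -, -, hψ, -, hlim⟩ := exists_subseq_limit hμ (h.comp_tendsto hσ.tendsto_atTop)
      (Eventually.of_forall hψs) (Eventually.of_forall fun n => (hgt n).le)
    have := hlim c (Eventually.of_forall fun n => (hgt _).le)
    exact absurd (this.trans (Psi_le_L hψ)) (not_le.2 hc)

/-- Maximizers for approximating measures converge, when the limiting maximizer is unique. -/
theorem tendsto_maximizer (hμ : ∀ a, μ {a}ᶜ ≠ 0) (h : Approx μs μ) (hbot : L μ ≠ ⊥)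
    (hL : Tendsto (fun n => L (μs n)) atTop (𝓝 (L μ))) {θ₀ : ℝ} {ψ₀ : ℝ → EReal}
    (huniq : ∀ θ ψ, IsMaximizer μ θ ψ → θ = θ₀ ∧ ψ = ψ₀) {θs : ℕ → ℝ} {ψs : ℕ → ℝ → EReal}
    (hmax : ∀ᶠ n in atTop, IsMaximizer (μs n) (θs n) (ψs n)) :
    ∀ σ : ℕ → ℕ, Tendsto σ atTop atTop → ∃ τ : ℕ → ℕ,
      Tendsto (fun n => θs (σ (τ n))) atTop (𝓝 θ₀) ∧
      HypoTendsto (fun n => ψs (σ (τ n))) ψ₀ := by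
  intro σ hσ
  have hev : ∀ c : ℝ, (c : EReal) < L μ →
      ∀ᶠ n in atTop, (c : EReal) ≤ Psi (θs n) (ψs n) (μs n) := by
    intro c hc
    filter_upwards [hmax, hL.eventually (lt_mem_nhds hc)] with n hn1 hn2
    rw [(isMaximizer_iff.1 hn1).2]
    exact hn2.le
  obtain ⟨c, -, hc⟩ := EReal.lt_iff_exists_real_btwn.1 (bot_lt_iff_ne_bot.2 hbot)
  obtain ⟨τ, θ, ψ, hτ, hθ, hψ, hlim, hle⟩ := exists_subseq_limit hμ (h.comp_tendsto hσ)
    (hσ.eventually (hmax.mono fun n hn => hn.1)) (hσ.eventually (hev c hc))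
  have hm : IsMaximizer μ θ ψ := isMaximizer_iff.2 ⟨hψ, (Psi_le_L hψ).antisymm
    (EReal.ge_of_forall_gt_iff_ge.1 fun t ht =>
      hle t (hτ.tendsto_atTop.eventually (hσ.eventually (hev t ht))))⟩
  obtain ⟨rfl, rfl⟩ := huniq θ ψ hm
  exact ⟨τ, hθ, hlim⟩

end consistency

/-! ### Pointwise, weighted integral and weighted uniform convergence -/

/-- Pointwise form of `HypoTendsto`. -/
structure EpiPointwise (ψs : ℕ → ℝ → EReal) (ψ : ℝ → EReal) : Prop where
  upper : ∀ x t, ψ x < t → ∀ᶠ n in atTop, ψs n x < t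
  lower : ∀ x ∈ interior (dom ψ), ∀ t, t < ψ x → ∀ᶠ n in atTop, t < ψs n x

lemma epiPointwise_of_subseq {ψs : ℕ → ℝ → EReal} {ψ : ℝ → EReal}
    (h : ∀ σ : ℕ → ℕ, Tendsto σ atTop atTop → ∃ τ : ℕ → ℕ,
      HypoTendsto (fun n => ψs (σ (τ n))) ψ) : EpiPointwise ψs ψ where
  upper _ _ ht := eventually_of_subseq fun σ hσ =>
    (h σ hσ.tendsto_atTop).imp fun _ hτ => (hτ.eventually_lt ht).frequently
  lower _ hx _ ht := eventually_of_subseq fun σ hσ =>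
    (h σ hσ.tendsto_atTop).imp fun _ hτ => (hτ.2 _ hx _ ht).frequently

section modes
variable {ψs : ℕ → ℝ → EReal} {ψ : ℝ → EReal}

lemma EpiPointwise.tendsto (h : EpiPointwise ψs ψ) {x : ℝ} (hx : x ∈ interior (dom ψ)) :
    Tendsto (fun n => ψs n x) atTop (𝓝 (ψ x)) :=
  tendsto_order.2 ⟨h.lower x hx, h.upper x⟩

lemma EpiPointwise.limsup_le (h : EpiPointwise ψs ψ) (x : ℝ) :
    limsup (fun n => ψs n x) atTop ≤ ψ x :=
  le_of_forall_gt_imp_ge_of_dense fun t ht =>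
    limsup_le_of_le (by isBoundedDefault) ((h.upper x t ht).mono fun _ hn => hn.le)

lemma EpiPointwise.tendsto_of_eq_bot (h : EpiPointwise ψs ψ) {x : ℝ} (hx : ψ x = ⊥) :
    Tendsto (fun n => ψs n x) atTop (𝓝 (ψ x)) :=
  tendsto_order.2 ⟨fun t ht => absurd ht (by simp [hx]), h.upper x⟩

/-- If `e^ψ` is positive and continuous at `x`, then `x` is interior to the domain; if it vanishes
at `x`, the upper bound alone suffices. -/
lemma EpiPointwise.tendsto_expFun_of_continuousAt (h : EpiPointwise ψs ψ)
    (hψ : ClosedProperConcave ψ) {x : ℝ} (hx : ContinuousAt (expFun ψ) x) :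
    Tendsto (fun n => expFun (ψs n) x) atTop (𝓝 (expFun ψ x)) := by
  refine tendsto_expFun (hψ.lt_top x) ?_
  by_cases hb : ψ x = ⊥
  · exact h.tendsto_of_eq_bot hb
  · refine h.tendsto (mem_interior_iff_mem_nhds.2 ?_)
    filter_upwards [hx.eventually (lt_mem_nhds ((expFun_pos_iff (hψ.lt_top x)).2 hb))] with y hy
    exact (expFun_pos_iff (hψ.lt_top y)).1 hy

lemma EpiPointwise.ae_tendsto_expFun (h : EpiPointwise ψs ψ) (hψ : ClosedProperConcave ψ) :
    ∀ᵐ x, Tendsto (fun n => expFun (ψs n) x) atTop (𝓝 (expFun ψ x)) := by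
  have h0 : volume (frontier (dom ψ)) = 0 := hψ.convex_dom.addHaar_frontier volume
  filter_upwards [compl_mem_ae_iff.2 h0] with x hx
  refine tendsto_expFun (hψ.lt_top x) ?_
  by_cases hd : ψ x = ⊥
  · exact h.tendsto_of_eq_bot hd
  · refine h.tendsto ?_
    by_contra hni
    exact hx ⟨subset_closure hd, hni⟩

lemma SC.zero_mem_interior_dom (hψ : SC 0 ψ) {z : ℝ} (hz : z ≠ 0) (h : ψ z ≠ ⊥) :
    (0 : ℝ) ∈ interior (dom ψ) := by
  refine mem_interior_iff_mem_nhds.2 (Filter.mem_of_superset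
    (Metric.ball_mem_nhds 0 (abs_pos.2 hz)) fun y hy => ?_)
  rw [Metric.mem_ball, Real.dist_eq, sub_zero] at hy
  exact ne_bot_of_le_ne_bot h (hψ.apply_le_of_abs_le hy.le)

/-- A common exponential envelope for a converging sequence and its limit. The rate depends only on
the limit. -/
lemma SC.exists_envelope (hψ : SC 0 ψ) (hI : ∫⁻ x, (ψ x).exp ≠ ⊤)
    (h0 : (0 : ℝ) ∈ interior (dom ψ)) :
    ∃ α > 0, ∃ B : ℝ, (∀ x, expFun ψ x ≤ Real.exp (B - α * |x|)) ∧
      ∀ ψs : ℕ → ℝ → EReal, (∀ᶠ n in atTop, SC 0 (ψs n)) → EpiPointwise ψs ψ →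
        ∀ᶠ n in atTop, ∀ x, expFun (ψs n) x ≤ Real.exp (B - α * |x|) := by
  obtain ⟨M, hM⟩ := hψ.exists_apply_zero
  obtain ⟨R, hR, hdrop⟩ := SC.exists_drop M (∫⁻ x, (ψ x).exp).toReal
  have hd := hdrop ψ hψ (ENNReal.ofReal_toReal hI).ge
  have hα : 1 / 2 / R ≤ 1 / R := by gcongr; norm_num
  refine ⟨1 / 2 / R, by positivity, M + 2, fun x => expFun_le ?_, fun ψs hs hlim => ?_⟩
  · refine (hψ.le_tent hM hR zero_le_one hd x).trans (EReal.coe_le_coe_iff.2 ?_)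
    have := mul_le_mul_of_nonneg_right hα (abs_nonneg x)
    linarith
  · have e1 := hlim.upper 0 ((M + 1 : ℝ) : EReal) (by
      rw [hM, EReal.coe_lt_coe_iff]; linarith)
    have e2 := hlim.lower 0 h0 ((M - 1 / 4 : ℝ) : EReal) (by
      rw [hM, EReal.coe_lt_coe_iff]; linarith)
    have e3 := hlim.upper R ((M - 3 / 4 : ℝ) : EReal) (hd.trans_lt (by
      rw [EReal.coe_lt_coe_iff]; linarith))
    filter_upwards [hs, e1, e2, e3] with n hn h1 h2 h3 x
    obtain ⟨m, hm⟩ := hn.exists_apply_zero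
    rw [hm, EReal.coe_lt_coe_iff] at h1 h2
    refine expFun_le ((hn.le_tent hm hR (d := 1 / 2) (by norm_num)
      (h3.le.trans (EReal.coe_le_coe_iff.2 (by linarith))) x).trans
      (EReal.coe_le_coe_iff.2 (by linarith)))

/-- The envelope of the weighted difference. -/
lemma weighted_le {f g α B a x : ℝ} (hf0 : 0 ≤ f) (hg0 : 0 ≤ g) (hf : f ≤ Real.exp (B - α * |x|))
    (hg : g ≤ Real.exp (B - α * |x|)) :
    Real.exp (a * |x|) * |f - g| ≤ Real.exp B * Real.exp (-((α - a) * |x|)) := by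
  have h1 : |f - g| ≤ Real.exp (B - α * |x|) := abs_sub_le_iff.2 ⟨by linarith, by linarith⟩
  refine (mul_le_mul_of_nonneg_left h1 (Real.exp_pos _).le).trans (le_of_eq ?_)
  rw [← Real.exp_add, ← Real.exp_add]
  ring_nf

lemma tendsto_weightedL1 {gs : ℕ → ℝ → ℝ} {g : ℝ → ℝ} {α B a : ℝ} (ha : a < α)
    (hm : ∀ᶠ n in atTop, Measurable (gs n)) (hgm : Measurable g)
    (hgs0 : ∀ n x, 0 ≤ gs n x) (hg0 : ∀ x, 0 ≤ g x) (hg : ∀ x, g x ≤ Real.exp (B - α * |x|))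
    (hgs : ∀ᶠ n in atTop, ∀ x, gs n x ≤ Real.exp (B - α * |x|))
    (hlim : ∀ᵐ x, Tendsto (fun n => gs n x) atTop (𝓝 (g x))) :
    Tendsto (fun n => weightedL1 a (gs n) g) atTop (𝓝 0) := by
  have hi : Integrable fun x : ℝ => Real.exp B * Real.exp (-((α - a) * |x|)) :=
    (integrable_exp_neg_mul_abs (sub_pos.2 ha)).const_mul _
  have := tendsto_lintegral_filter_of_dominated_convergence (μ := volume) (l := atTop)
    (F := fun n x => ENNReal.ofReal (Real.exp (a * |x|) * |gs n x - g x|)) (f := fun _ => 0)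
    (fun x => ENNReal.ofReal (Real.exp B * Real.exp (-((α - a) * |x|)))) ?_ ?_
    hi.lintegral_lt_top.ne ?_
  · simpa [weightedL1] using this
  · filter_upwards [hm] with n hn
    fun_prop
  · filter_upwards [hgs] with n hn
    exact Eventually.of_forall fun x =>
      ENNReal.ofReal_le_ofReal (weighted_le (hgs0 n x) (hg0 x) (hn x) (hg x))
  · filter_upwards [hlim] with x hx
    have h1 : Tendsto (fun n => Real.exp (a * |x|) * |gs n x - g x|) atTop (𝓝 0) := by
      have := ((hx.sub_const (g x)).abs).const_mul (Real.exp (a * |x|))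
      simpa using this
    simpa using ENNReal.tendsto_ofReal h1

/-- Pointwise convergence of monotone functions to a continuous limit is locally uniform. -/
lemma tendstoUniformlyOn_of_antitoneOn {gs : ℕ → ℝ → ℝ} {g : ℝ → ℝ}
    (hmono : ∀ᶠ n in atTop, AntitoneOn (gs n) (Set.Ici 0)) (hg : Continuous g)
    (hlim : ∀ x, Tendsto (fun n => gs n x) atTop (𝓝 (g x))) (T : ℝ) :
    TendstoUniformlyOn gs g atTop (Set.Icc 0 T) := by
  rw [← tendstoLocallyUniformlyOn_iff_tendstoUniformlyOn_of_compact isCompact_Icc,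
    Metric.tendstoLocallyUniformlyOn_iff]
  intro ε hε x hx
  obtain ⟨δ, hδ, hball⟩ := Metric.continuousAt_iff.1 hg.continuousAt (ε / 4) (by positivity)
  have hclose : ∀ y, |y - x| < δ → |g y - g x| < ε / 4 := fun y hy => by
    have := hball (x := y) (by rwa [Real.dist_eq])
    rwa [Real.dist_eq] at this
  refine ⟨Metric.ball x (δ / 2) ∩ Set.Icc 0 T, Filter.inter_mem
    (mem_nhdsWithin_of_mem_nhds (Metric.ball_mem_nhds x (by positivity))) self_mem_nhdsWithin, ?_⟩
  -- The values near `x` are squeezed between those at `u` and at `x + δ / 2`; the maximum with `0`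
  -- keeps `u` where the functions are antitone.
  obtain ⟨u, hu⟩ : ∃ u, u = max (x - δ / 2) 0 := ⟨_, rfl⟩
  have hu0 : 0 ≤ u := hu ▸ le_max_right _ _
  have hux : u ≤ x := hu ▸ max_le (by linarith) hx.1
  have hux' : x - δ / 2 ≤ u := hu ▸ le_max_left _ _
  have e1 := (hlim u).eventually (Metric.ball_mem_nhds (g u) (show 0 < ε / 4 by positivity))
  have e2 := (hlim (x + δ / 2)).eventually
    (Metric.ball_mem_nhds (g (x + δ / 2)) (show 0 < ε / 4 by positivity))
  filter_upwards [hmono, e1, e2] with n hn h1 h2 y hy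
  rw [Real.dist_eq] at h1 h2
  have hyx : |y - x| < δ / 2 := by rw [← Real.dist_eq]; exact hy.1
  obtain ⟨hy1, hy2⟩ := abs_lt.1 hyx
  have huy : u ≤ y := hu ▸ max_le (by linarith) hy.2.1
  have m1 : gs n y ≤ gs n u := hn hu0 hy.2.1 huy
  have m2 : gs n (x + δ / 2) ≤ gs n y :=
    hn hy.2.1 (show (0 : ℝ) ≤ x + δ / 2 by linarith [hx.1]) (by linarith)
  have c1 := abs_lt.1 (hclose u (abs_lt.2 ⟨by linarith, by linarith⟩))
  have c2 := abs_lt.1 (hclose (x + δ / 2) (abs_lt.2 ⟨by linarith, by linarith⟩))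
  have c3 := abs_lt.1 (hclose y (abs_lt.2 ⟨by linarith, by linarith⟩))
  rw [abs_lt] at h1 h2
  rw [Real.dist_eq, abs_lt]
  constructor <;> linarith

/-- Beyond a radius `T` the envelope makes the weighted difference small; on `[0, T]` convergence is
uniform, and evenness covers the negative side. -/
lemma tendsto_weightedSup {gs : ℕ → ℝ → ℝ} {g : ℝ → ℝ} {α B a : ℝ} (ha : a < α)
    (hgs0 : ∀ n x, 0 ≤ gs n x) (hg0 : ∀ x, 0 ≤ g x) (hg : ∀ x, g x ≤ Real.exp (B - α * |x|))
    (hgs : ∀ᶠ n in atTop, ∀ x, gs n x ≤ Real.exp (B - α * |x|))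
    (hmono : ∀ᶠ n in atTop, AntitoneOn (gs n) (Set.Ici 0))
    (heven : ∀ᶠ n in atTop, SymmAbout 0 (gs n)) (hgeven : SymmAbout 0 g) (hgc : Continuous g)
    (hlim : ∀ x, Tendsto (fun n => gs n x) atTop (𝓝 (g x))) :
    Tendsto (fun n => weightedSup a (gs n) g) atTop (𝓝 0) := by
  rw [ENNReal.tendsto_nhds_zero]
  intro ε' hε'
  rcases eq_or_ne ε' ⊤ with rfl | hne
  · exact Eventually.of_forall fun _ => le_top
  lift ε' to NNReal using hne
  have hε : (0 : ℝ) < ε' := by exact_mod_cast hε'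
  have htail : Tendsto (fun T : ℝ => Real.exp B * Real.exp (-((α - a) * T))) atTop (𝓝 0) := by
    have h1 : Tendsto (fun T : ℝ => (α - a) * T) atTop atTop :=
      tendsto_id.const_mul_atTop (sub_pos.2 ha)
    have := ((Real.tendsto_exp_neg_atTop_nhds_zero).comp h1).const_mul (Real.exp B)
    simpa using this
  obtain ⟨T, hT, hT0⟩ := ((htail.eventually (gt_mem_nhds hε)).and (eventually_ge_atTop 0)).exists
  have hunif := Metric.tendstoUniformlyOn_iff.1
    (tendstoUniformlyOn_of_antitoneOn hmono hgc hlim T) (ε' * Real.exp (-(|a| * T))) (by positivity)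
  filter_upwards [hunif, heven, hgs] with n h1 h2 h3
  refine iSup_le fun x => ?_
  rw [← ENNReal.ofReal_coe_nnreal]
  refine ENNReal.ofReal_le_ofReal ?_
  rcases le_total |x| T with hx | hx
  · have h4 := h1 |x| ⟨abs_nonneg x, hx⟩
    rw [dist_comm, Real.dist_eq, h2.abs, hgeven.abs] at h4
    have h5 : Real.exp (a * |x|) ≤ Real.exp (|a| * T) :=
      Real.exp_le_exp.2 (mul_le_mul (le_abs_self a) hx (abs_nonneg x) (abs_nonneg a))
    calc Real.exp (a * |x|) * |gs n x - g x|
        ≤ Real.exp (|a| * T) * (ε' * Real.exp (-(|a| * T))) := by gcongr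
      _ = ε' * (Real.exp (|a| * T) * Real.exp (-(|a| * T))) := by ring
      _ = ε' := by rw [← Real.exp_add]; simp
  · refine (weighted_le (hgs0 n x) (hg0 x) (h3 x) (hg x)).trans (le_trans ?_ hT.le)
    have : (α - a) * T ≤ (α - a) * |x| := by
      have := sub_pos.2 ha
      gcongr
    gcongr

lemma SC.antitoneOn_expFun (h : SC 0 ψ) : AntitoneOn (expFun ψ) (Set.Ici 0) := by
  intro x hx y hy hxy
  refine ENNReal.toReal_mono (EReal.exp_lt_top_iff.2 (h.1.lt_top x)).ne (EReal.exp_monotone ?_)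
  exact h.apply_le_of_abs_le (abs_le_abs_of_nonneg hx hxy)

lemma SC.symmAbout_expFun (h : SC 0 ψ) : SymmAbout 0 (expFun ψ) := fun x => by
  simp only [expFun, h.2 x]

end modes

end SymmLoc

/-! ### The main theorem -/

open SymmLoc in
theorem mainTheorem7 (f₀ : ℝ → ℝ) (θ₀ : ℝ) (hsymm : SymmAbout θ₀ f₀) :
    (MemP0 f₀ → MemP1 f₀) ∧
    (MemP1 f₀ →
      ∃ ψs : ℝ → EReal,
        -- `exp ψs` is a density, and it is the log-concave projection of `g₀ = f₀(· + θ₀)`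
        IsLogConcaveProjection (law fun x => f₀ (x + θ₀)) ψs ∧
        (∀ φ, IsLogConcaveProjection (law fun x => f₀ (x + θ₀)) φ → φ = ψs) ∧
        IsDensity (expFun ψs) ∧
        -- `(θ₀, ψs)` is the unique maximizer of the population criterion
        IsMaximizer (law f₀) θ₀ ψs ∧
        (∀ θ ψ, IsMaximizer (law f₀) θ ψ → θ = θ₀ ∧ ψ = ψs) ∧
        L (law f₀) ≠ ⊥ ∧ L (law f₀) ≠ ⊤ ∧
        -- the well-specified case
        (MemP0 f₀ →
          ψs = logFun (fun x => f₀ (x + θ₀)) ∧ ∀ x, expFun ψs x = f₀ (x + θ₀)) ∧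
        ∃ α : ℝ, 0 < α ∧
          ∀ (Ω : Type*) [MeasurableSpace Ω] (P : Measure Ω) [IsProbabilityMeasure P]
            (X : ℕ → Ω → ℝ),
            (∀ i, HasLaw (X i) (law f₀) P) → iIndepFun X P →
            -- maximum likelihood estimates exist, and the maximized criterion converges
            (∀ᵐ ω ∂P, ∀ n ≥ 2, ∃ θ ψ, IsMLE (fun i => X i ω) n θ ψ) ∧
            (∀ᵐ ω ∂P, Tendsto (fun n => L (empirical (fun i => X i ω) n)) atTop
              (𝓝 (L (law f₀)))) ∧
            -- every version of the estimator
            ∀ (θh : ℕ → Ω → ℝ) (ψh : ℕ → Ω → ℝ → EReal),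
              (∀ᵐ ω ∂P, ∀ᶠ n in atTop, IsMLE (fun i => X i ω) n (θh n ω) (ψh n ω)) →
              (∀ᵐ ω ∂P, Tendsto (fun n => θh n ω) atTop (𝓝 θ₀)) ∧
              (∀ᵐ ω ∂P, ∀ x ∈ interior (dom ψs),
                Tendsto (fun n => ψh n ω x) atTop (𝓝 (ψs x))) ∧
              (∀ᵐ ω ∂P, ∀ x, limsup (fun n => ψh n ω x) atTop ≤ ψs x) ∧
              (∀ᵐ ω ∂P, ∀ x, ContinuousAt (expFun ψs) x →
                Tendsto (fun n => expFun (ψh n ω) x) atTop (𝓝 (expFun ψs x))) ∧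
              (∀ᵐ ω ∂P, ∀ α₁ < α,
                Tendsto (fun n => weightedL1 α₁ (expFun (ψh n ω)) (expFun ψs)) atTop (𝓝 0)) ∧
              (Continuous (expFun ψs) → ∀ᵐ ω ∂P, ∀ α₁ < α,
                Tendsto (fun n => weightedSup α₁ (expFun (ψh n ω)) (expFun ψs)) atTop (𝓝 0)) ∧
              (MemP0 f₀ →
                (∀ᵐ ω ∂P, ∀ x,
                  Tendsto (fun n => expFun (ψh n ω) x) atTop (𝓝 (f₀ (x + θ₀)))) ∧
                (∀ᵐ ω ∂P, ∀ α₁ < α,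
                  Tendsto (fun n => weightedSup α₁ (expFun (ψh n ω)) fun x => f₀ (x + θ₀))
                    atTop (𝓝 0)))) := by
  refine ⟨MemP0.memP1, fun h1 => ?_⟩
  obtain ⟨hf, -, -, hm⟩ := h1
  have hg := hf.comp_add θ₀
  have hgs : SymmAbout 0 fun x => f₀ (x + θ₀) := fun x => by
    have := hsymm x
    simp only [zero_add, zero_sub]
    rwa [add_comm x, neg_add_eq_sub]
  have := isProbabilityMeasure_law hf
  have := isProbabilityMeasure_law hg
  have hac := law_absolutelyContinuous f₀
  have hmf := lintegral_abs_law_ne_top hf hm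
  obtain ⟨ψs, hψ, hfin, hmax, huniq⟩ := exists_projection (map_neg_law hg hgs)
    (law_absolutelyContinuous _) (lintegral_abs_law_comp_add_ne_top hf θ₀ hmf)
  have hone := lintegral_exp_eq_one hfin hψ.1 hmax
  have hI : ∫⁻ x, (ψs x).exp ≠ ⊤ := by rw [hone]; exact ENNReal.one_ne_top
  have hPsi : Psi θ₀ ψs (law f₀) = omega ψs (law fun x => f₀ (x + θ₀)) := by
    rw [Psi_law hf θ₀ θ₀ hψ.1.measurable]
    simp only [sub_self, sub_zero]
  have hmaxim : IsMaximizer (law f₀) θ₀ ψs := ⟨hψ, fun θ' ψ' h' => by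
    rw [hPsi, Psi_law hf θ₀ θ' h'.1.measurable]
    exact hmax _ (h'.1.comp_sub _)⟩
  have huniqmax : ∀ θ ψ, IsMaximizer (law f₀) θ ψ → θ = θ₀ ∧ ψ = ψs := by
    intro θ ψ h
    -- Any maximizer, recentred by `θ₀`, is a log-concave projection and so equals `ψ*`, which is
    -- then symmetric about both `0` and `θ - θ₀`.
    have heq : (fun x => ψ (x - (θ - θ₀))) = ψs := by
      refine huniq _ (h.1.1.comp_sub _) ?_
      rw [← Psi_law hf θ₀ θ h.1.1.measurable, ← hPsi]
      exact (hmaxim.2 θ ψ h.1).antisymm (h.2 θ₀ ψs hψ)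
    have h0 : θ - θ₀ = 0 := hψ.eq_zero_of_symmAbout hI fun x => by
      rw [← heq]
      simp only [add_sub_cancel_left, sub_sub_cancel_left, h.1.2.neg]
    refine ⟨sub_eq_zero.1 h0, ?_⟩
    rw [← heq, h0]
    simp only [sub_zero]
  have hLeq : L (law f₀) = omega ψs (law fun x => f₀ (x + θ₀)) := by
    rw [← (isMaximizer_iff.1 hmaxim).2, hPsi]
  have hLbot : L (law f₀) ≠ ⊥ := L_ne_bot hmf
  have hspec : MemP0 f₀ → ψs = logFun (fun x => f₀ (x + θ₀)) ∧
      ∀ x, expFun ψs x = f₀ (x + θ₀) := by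
    intro h0
    have hslc := h0.slc hsymm
    have heq := huniq _ hslc.2.1 ((hmax _ hslc.2.1).antisymm (hslc.omega_le hψ.1))
    refine ⟨heq.symm, fun x => ?_⟩
    rw [← heq]
    exact expFun_logFun (hg.nonneg x)
  have hcont : MemP0 f₀ → Continuous (expFun ψs) := by
    intro h0
    rw [funext (hspec h0).2]
    exact h0.continuous.comp (by fun_prop)
  -- The law has no atom at `0`, so the domain contains some `z ≠ 0` and with it the interval
  -- between `-|z|` and `|z|`.
  have hint : (0 : ℝ) ∈ interior (dom ψs) := by
    have hne : ∀ᵐ x ∂(law fun x => f₀ (x + θ₀)), x ≠ 0 :=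
      (law_absolutelyContinuous _).ae_le (compl_mem_ae_iff.2 (measure_singleton (0 : ℝ)))
    obtain ⟨z, hz, hz0⟩ := (hfin.ae_ne_bot.and hne).exists
    exact hψ.zero_mem_interior_dom hz0 hz
  -- The rate `α` is fixed here from `ψ*` alone, before any sample or estimator is introduced.
  obtain ⟨α, hα, B, hB, hBn⟩ := hψ.exists_envelope hI hint
  refine ⟨ψs, ⟨hψ.1, hmax⟩, fun φ hφ => huniq φ hφ.1 ((hmax φ hφ.1).antisymm (hφ.2 _ hψ.1)),
    isDensity_expFun hψ.1 hone, hmaxim, huniqmax, hLbot, ?_, hspec, α, hα, ?_⟩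
  · rw [hLeq, hfin.omega_eq hψ.1.lt_top]
    exact EReal.coe_ne_top _
  intro Ω _ P _ X hX hi
  have happ := ae_approx_empirical hX hi hmf
  have hpt := compl_singleton_ne_zero hac
  have hfin' : OmegaFinite (fun x => ψs (x - θ₀)) (law f₀) := by
    refine finite_of_omega_ne_bot (hψ.1.comp_sub θ₀).measurable (hψ.1.comp_sub θ₀).lt_top ?_ ?_
    · obtain ⟨M, hM⟩ := hψ.exists_apply_zero
      exact lintegral_toENNReal_ne_top_of_le fun x => hM ▸ hψ.apply_le_zero (x - θ₀)
    · change Psi θ₀ ψs (law f₀) ≠ ⊥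
      rwa [hPsi, ← hLeq]
  have hL : ∀ᵐ ω ∂P, Tendsto (fun n => L (empirical (fun i => X i ω) n)) atTop
      (𝓝 (L (law f₀))) := by
    filter_upwards [happ, ae_tendsto_Psi_empirical hX hi hψ.1 hfin'] with ω hω1 hω2
    rw [hPsi, ← hLeq] at hω2
    -- The lower half comes from the strong law at the single pair `(θ₀, ψ*)`, whose empirical
    -- criterion is a lower bound for the empirical `L`.
    refine tendsto_L hpt hω1 fun c hc => ?_
    exact (hω2.eventually (lt_mem_nhds hc)).mono fun n hn => hn.trans_le (Psi_le_L hψ)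
  refine ⟨?_, hL, fun θh ψh hmle => ?_⟩
  · have : NullSingletonClass (law f₀) := ⟨fun x => hac (by simp)⟩
    filter_upwards [ae_ne_of_nullSingleton hX hi] with ω hω n hn
    exact exists_isMLE hn hω
  have hconv : ∀ᵐ ω ∂P, (∀ᶠ n in atTop, SC 0 (ψh n ω)) ∧
      Tendsto (fun n => θh n ω) atTop (𝓝 θ₀) ∧ EpiPointwise (fun n => ψh n ω) ψs := by
    filter_upwards [happ, hL, hmle] with ω hω1 hω2 hω3
    have hsub := tendsto_maximizer hpt hω1 hLbot hω2 huniqmax hω3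
    exact ⟨hω3.mono fun n hn => hn.1,
      tendsto_of_subseq_tendsto fun σ hσ => (hsub σ hσ).imp fun _ h => h.1,
      epiPointwise_of_subseq fun σ hσ => (hsub σ hσ).imp fun _ h => h.2⟩
  have hsup : Continuous (expFun ψs) → ∀ᵐ ω ∂P, ∀ α₁ < α,
      Tendsto (fun n => weightedSup α₁ (expFun (ψh n ω)) (expFun ψs)) atTop (𝓝 0) := by
    intro hc
    filter_upwards [hconv] with ω ⟨hSC, _, hlim⟩ α₁ hα₁
    exact tendsto_weightedSup hα₁ (fun n => expFun_nonneg _) (expFun_nonneg _) hB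
      (hBn _ hSC hlim) (hSC.mono fun n hn => hn.antitoneOn_expFun)
      (hSC.mono fun n hn => hn.symmAbout_expFun) hψ.symmAbout_expFun hc
      fun x => hlim.tendsto_expFun_of_continuousAt hψ.1 hc.continuousAt
  have hptw : ∀ᵐ ω ∂P, ∀ x, ContinuousAt (expFun ψs) x →
      Tendsto (fun n => expFun (ψh n ω) x) atTop (𝓝 (expFun ψs x)) :=
    hconv.mono fun ω hω x hx => hω.2.2.tendsto_expFun_of_continuousAt hψ.1 hx
  refine ⟨hconv.mono fun ω hω => hω.2.1, hconv.mono fun ω hω x hx => hω.2.2.tendsto hx,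
    hconv.mono fun ω hω x => hω.2.2.limsup_le x, hptw, ?_, hsup, fun h0 => ⟨?_, ?_⟩⟩
  · filter_upwards [hconv] with ω ⟨hSC, _, hlim⟩ α₁ hα₁
    exact tendsto_weightedL1 hα₁ (hSC.mono fun n hn => measurable_expFun hn.1.measurable)
      (measurable_expFun hψ.1.measurable) (fun n => expFun_nonneg _) (expFun_nonneg _) hB
      (hBn _ hSC hlim) (hlim.ae_tendsto_expFun hψ.1)
  · filter_upwards [hptw] with ω hω x
    rw [← (hspec h0).2 x]
    exact hω x (hcont h0).continuousAt
  · have := hsup (hcont h0)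
    rwa [funext (hspec h0).2] at this
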